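/- Let $p,q>0$ with $p+q=1$, and let $P_{n+2}$ be the path with vertices $0,1,\dots,n+1$. Consider the discrete-time quantum walk on the Hilbert space with orthonormal basis $|0,R\rangle,|1,L\rangle,|1,R\rangle,\dots,|n,L\rangle,|n,R\rangle,|n+1,L\rangle$, with time evolution $U^{(n)}=S^{(n)}C^{(n)}$. Here the coin operator $C^{(n)}$ acts as $2|\phi\rangle\langle\phi|-I_2$ with $|\phi\rangle=\sqrt q\,|L\rangle+\sqrt p\,|R\rangle$ on the chirality at each vertex $1,\dots,n$, and as the identity on $|0,R\rangle$ and on $|n+1,L\rangle$; the shift operator is $S^{(n)}|x,R\rangle=|x+1,L\rangle$, $S^{(n)}|x,L\rangle=|x-1,R\rangle$. The walk starts from a vertex $i$ with uniformly random chirality among the basis states at $i$ (so $|0,R\rangle$ if $i=0$, $|n+1,L\rangle$ if $i=n+1$, and $|i,L\rangle$ or $|i,R\rangle$ with probability $1/2$ each otherwise). Let $$\overline p^{(n)}_i(x)=\lim_{T\to\infty}\mathbb E\Big[\frac1T\sum_{t=0}^{T-1}\big\|(\langle x|\otimes I_2)(U^{(n)})^t|\psi\rangle\big\|^2\Big],$$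 where the expectation is over the initial state $|\psi\rangle$. These limits exist and $\overline p^{(n)}_i$ is a probability distribution on the vertices. Let $\overline X^{(n)}_i$ be a random variable with this distribution. Then, as $n\to\infty$, with $\Rightarrow$ denoting weak convergence and $U(0,1)$ the uniform distribution on $[0,1]$: (1) For every fixed starting vertex $i\ge 0$, $$\overline X^{(n)}_i/n\Rightarrow c_i\,\delta_0+(1-c_i)\,U(0,1),$$ where $c_i=0$ if $p\ge q$, and if $p<q$ then $c_0=1-\frac pq$ and $c_i=\frac1{2q}\big(1-\frac pq\big)\big(\frac pq\big)^{i-1}$ for $i\ge1$. (2) Let $0<r<1$, let $f(n)\to\infty$ with $r f(n)\le n$, and let the starting vertex $i=i(n)\in\{0,\dots,n+1\}$ satisfy $i(n)/f(n)\to r$; if $p>q$, suppose also that the starting vertex does not stay near the right end of the path, i.e. $n-i(n)\to\infty$. Then $$\overline X^{(n)}_{i(n)}/n\Rightarrow U(0,1).$$ -/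

import Mathlib

open MeasureTheory Filter Topology

noncomputable section

namespace PathWalk

/-- The chirality of the walker: `L` is a move to the left, `R` a move to the right. -/
inductive Chirality where
  | L : Chirality
  | R : Chirality
  deriving DecidableEq

instance : Fintype Chirality where
  elems := {Chirality.L, Chirality.R}
  complete := by intro J; cases J <;> simp

/-- The labels `(x, J)` of the orthonormal basis `|x, J⟩` of the Hilbert space of the walk on the
path with vertices `0, 1, …, n + 1`: all pairs except `(0, L)` and `(n + 1, R)`. -/
abbrev Arc (n : ℕ) : Type :=
  {s : Fin (n + 2) × Chirality //
    ¬ (s.1 = 0 ∧ s.2 = Chirality.L) ∧ ¬ (s.1 = Fin.last (n + 1) ∧ s.2 = Chirality.R)}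

/-- The vertex of a basis state. -/
def Arc.pos {n : ℕ} (s : Arc n) : Fin (n + 2) := s.1.1

/-- The chirality of a basis state. -/
def Arc.chir {n : ℕ} (s : Arc n) : Chirality := s.1.2

/-- The components of `|φ⟩ = √q |L⟩ + √p |R⟩`. -/
def phi (p q : ℝ) : Chirality → ℝ
  | Chirality.L => Real.sqrt q
  | Chirality.R => Real.sqrt p

/-- The coin operator: `2|φ⟩⟨φ| - I` at every inner vertex, and the identity on the
one-dimensional coin space of each of the two end vertices. -/
def coin (p q : ℝ) (n : ℕ) : Matrix (Arc n) (Arc n) ℂ :=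
  Matrix.of fun t s =>
    if t.pos = s.pos then
      if s.pos = 0 ∨ s.pos = Fin.last (n + 1) then 1
      else ((2 * phi p q t.chir * phi p q s.chir - (if t.chir = s.chir then 1 else 0) : ℝ) : ℂ)
    else 0

/-- The shift operator: `|x, R⟩ ↦ |x + 1, L⟩` and `|x, L⟩ ↦ |x - 1, R⟩`. -/
def shift (n : ℕ) : Matrix (Arc n) (Arc n) ℂ :=
  Matrix.of fun t s =>
    if (s.chir = Chirality.R ∧ t.chir = Chirality.L ∧ (t.pos : ℕ) = (s.pos : ℕ) + 1) ∨
       (s.chir = Chirality.L ∧ t.chir = Chirality.R ∧ (t.pos : ℕ) + 1 = (s.pos : ℕ))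
    then 1 else 0

/-- The time evolution operator `U = S C`. -/
def evolution (p q : ℝ) (n : ℕ) : Matrix (Arc n) (Arc n) ℂ := shift n * coin p q n

/-- The probability `‖(⟨x| ⊗ I) U ^ t ψ‖²` of finding the walker with initial state `ψ` at the
vertex `x` at time `t`. -/
def prob (p q : ℝ) (n : ℕ) (ψ : Arc n → ℂ) (t : ℕ) (x : Fin (n + 2)) : ℝ :=
  ∑ s : Arc n with s.pos = x, ‖((evolution p q n ^ t).mulVec ψ) s‖ ^ 2

/-- The basis states at the vertex `i`: `|i, L⟩` and `|i, R⟩` at an inner vertex,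
`|0, R⟩` for `i = 0`, and `|n + 1, L⟩` for `i = n + 1`. -/
def startStates (n : ℕ) (i : Fin (n + 2)) : Finset (Arc n) :=
  Finset.univ.filter fun s => s.pos = i

/-- The average over the times `0, …, T - 1` of the probability of finding the walker at `x`, in
expectation over the initial chirality, which is uniform on the basis states at the vertex `i`. -/
def finiteTimeAverage (p q : ℝ) (n : ℕ) (i x : Fin (n + 2)) (T : ℕ) : ℝ :=
  (∑ s ∈ startStates n i,
      (1 / (T : ℝ)) * ∑ t ∈ Finset.range T, prob p q n (Pi.single s 1) t x) /
    ((startStates n i).card : ℝ)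

/-- The time averaged distribution of the walk that starts from the vertex `i`. -/
def timeAveraged (p q : ℝ) (n : ℕ) (i x : Fin (n + 2)) : ℝ :=
  limUnder atTop (finiteTimeAverage p q n i x)

/-- The law on `ℝ` of `X / n`, where `X` has the time averaged distribution. -/
def scaledLaw (p q : ℝ) (n : ℕ) (i : Fin (n + 2)) : Measure ℝ :=
  ∑ x : Fin (n + 2),
    ENNReal.ofReal (timeAveraged p q n i x) • Measure.dirac (((x : ℕ) : ℝ) / (n : ℝ))

/-- The uniform distribution on `[0, 1]`. -/
def uniform01 : Measure ℝ := volume.restrict (Set.Icc 0 1)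

/-- The mass `c_i` of the limit law at the origin. -/
def originMass (p q : ℝ) (i : ℕ) : ℝ :=
  if p < q then
    if i = 0 then 1 - p / q else 1 / (2 * q) * (1 - p / q) * (p / q) ^ (i - 1)
  else 0

/-- The mixture `c δ₀ + (1 - c) U(0, 1)`. -/
def mixture (c : ℝ) : Measure ℝ :=
  ENNReal.ofReal c • Measure.dirac 0 + ENNReal.ofReal (1 - c) • uniform01

/-- All the measures are probability measures, and `μ n` converges weakly to `ν`. -/
def WeaklyConverges (μ : ℕ → Measure ℝ) (ν : Measure ℝ) : Prop :=
  ∃ (hμ : ∀ n, IsProbabilityMeasure (μ n)) (hν : IsProbabilityMeasure ν),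
    Tendsto (β := ProbabilityMeasure ℝ) (fun n => ⟨μ n, hμ n⟩) atTop (𝓝 ⟨ν, hν⟩)

end PathWalk

end

noncomputable section

namespace PathWalk

open Matrix

/-! The evolution is diagonalized explicitly. Its spectrum is simple, so time averaging removes all
interference, and the averaged probability of going from arc `s` to arc `r` is the sum over unit
eigenvectors of the product of their squared moduli at `s` and `r`.

The eigenvalues are `±1`, and `e^{±iθ_k}` with `cos θ_k = 2√(pq) cos(kπ/(n+1))` for `1 ≤ k ≤ n`; the
latter lift eigenvectors of the Jacobi matrix of the random walk with reflecting ends. The squared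
modulus of an eigenvector depends only on the edge and on `k`, neither on the orientation nor on the
sign. For `±1` it is proportional to `(p/q)^e`; for `k ≠ 0` it is flat up to an oscillating term
(`norm_sq_eigenvector`).

The walk is therefore nearly a mixture: with weight `overlap` it is in the geometric state,
otherwise in the flat one. The error is `O(n^{-1/2})`, because Parseval bounds the oscillating
coefficients of a test function in mean square (`abs_edgeMean_sub_le`). It remains to pass to the
limit: flat means tend to the integral over `[0,1]`, the geometric state collapses to the origin
when `p < q`, and the overlap tends to `c_i` or to `0`. When `p > q` the geometric state sits at the
right end, so a start far from that end does not see it. Bounded Lipschitz test functions then give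
weak convergence (`weaklyConverges_mixture`). -/

/-! ### Time averages of a unitary evolution with simple spectrum. -/

theorem tendsto_average_pow {z : ℂ} (hz : ‖z‖ = 1) :
    Tendsto (fun T : ℕ => (1 / (T : ℂ)) * ∑ t ∈ Finset.range T, z ^ t) atTop
      (𝓝 (if z = 1 then 1 else 0)) := by
  split_ifs with h
  · subst h
    refine tendsto_const_nhds.congr' ?_
    filter_upwards [eventually_gt_atTop 0] with T hT
    have : (T : ℂ) ≠ 0 := by exact_mod_cast hT.ne'
    simp [this]
  · have h1 : z - 1 ≠ 0 := sub_ne_zero.mpr h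
    rw [tendsto_zero_iff_norm_tendsto_zero]
    have h2 : Tendsto (fun T : ℕ => (2 / ‖z - 1‖) * (1 / (T : ℝ))) atTop (𝓝 0) := by
      simpa using (tendsto_one_div_atTop_nhds_zero_nat (𝕜 := ℝ)).const_mul (2 / ‖z - 1‖)
    refine squeeze_zero (fun _ => norm_nonneg _) (fun T => ?_) h2
    rw [geom_sum_eq h, norm_mul, norm_div, mul_comm, norm_div, norm_one, Complex.norm_natCast]
    gcongr
    calc ‖z ^ T - 1‖ ≤ ‖z ^ T‖ + ‖(1 : ℂ)‖ := norm_sub_le _ _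
      _ = 2 := by rw [norm_pow, hz]; norm_num

theorem pow_mul_of_mul_eq_mul_diagonal {m j : Type*} [Fintype m] [DecidableEq m] [Fintype j]
    [DecidableEq j] {U : Matrix m m ℂ} {V : Matrix m j ℂ} {μ : j → ℂ}
    (h : U * V = V * diagonal μ) (t : ℕ) : U ^ t * V = V * diagonal (fun k => μ k ^ t) := by
  induction t with
  | zero => simp
  | succ t ih =>
    rw [pow_succ, Matrix.mul_assoc, h, ← Matrix.mul_assoc, ih, Matrix.mul_assoc, diagonal_mul_diagonal]
    simp only [pow_succ]

/-- The time averaged transition probabilities of a unitary evolution with simple spectrum. -/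
theorem tendsto_average_normSq {m j : Type*} [Fintype m] [DecidableEq m] [Fintype j]
    [DecidableEq j] {U : Matrix m m ℂ} {V : Matrix m j ℂ} {μ : j → ℂ}
    (hV : V * Vᴴ = 1) (h : U * V = V * diagonal μ) (hμ : ∀ k, ‖μ k‖ = 1)
    (hinj : Function.Injective μ) (s r : m) :
    Tendsto (fun T : ℕ => (1 / (T : ℝ)) *
        ∑ t ∈ Finset.range T, ‖((U ^ t).mulVec (Pi.single s 1)) r‖ ^ 2) atTop
      (𝓝 (∑ k, ‖V s k‖ ^ 2 * ‖V r k‖ ^ 2)) := by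
  have hU : ∀ t : ℕ, ((U ^ t).mulVec (Pi.single s 1)) r
      = ∑ k, V r k * star (V s k) * μ k ^ t := by
    intro t
    have : U ^ t = V * diagonal (fun k => μ k ^ t) * Vᴴ := by
      rw [← pow_mul_of_mul_eq_mul_diagonal h, Matrix.mul_assoc, hV, Matrix.mul_one]
    rw [mulVec_single_one, this, Matrix.col_apply, Matrix.mul_apply]
    simp only [mul_diagonal, conjTranspose_apply]
    exact Finset.sum_congr rfl fun k _ => by ring
  have hsq : ∀ t : ℕ, ((‖((U ^ t).mulVec (Pi.single s 1)) r‖ ^ 2 : ℝ) : ℂ)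
      = ∑ k, ∑ l, (V r k * star (V s k) * star (V r l * star (V s l))) *
          (μ k * star (μ l)) ^ t := by
    intro t
    rw [hU]
    push_cast
    rw [← Complex.mul_conj', map_sum, Finset.sum_mul_sum]
    refine Finset.sum_congr rfl fun k _ => Finset.sum_congr rfl fun l _ => ?_
    simp only [map_mul, map_pow, mul_pow, star_mul', Complex.star_def,
      Complex.conj_conj]
    ring
  -- Simplicity of the spectrum enters here: only diagonal pairs have a constant phase, so the
  -- Cesàro means of all cross terms vanish.
  have hone : ∀ k l, μ k * star (μ l) = 1 ↔ k = l := by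
    intro k l
    have hl : μ l * star (μ l) = 1 := by
      rw [Complex.star_def, Complex.mul_conj', hμ]; norm_num
    constructor
    · intro hk
      apply hinj
      have : μ k * star (μ l) * μ l = μ l := by rw [hk, one_mul]
      rw [mul_assoc, mul_comm (star (μ l)), hl, mul_one] at this
      exact this
    · rintro rfl; exact hl
  have hlim : Tendsto (fun T : ℕ => ∑ k, ∑ l,
      (V r k * star (V s k) * star (V r l * star (V s l))) *
        ((1 / (T : ℂ)) * ∑ t ∈ Finset.range T, (μ k * star (μ l)) ^ t)) atTop
      (𝓝 (∑ k, ∑ l, (V r k * star (V s k) * star (V r l * star (V s l))) *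
        (if μ k * star (μ l) = 1 then 1 else 0))) := by
    refine tendsto_finsetSum _ fun k _ => tendsto_finsetSum _ fun l _ => ?_
    refine (tendsto_average_pow ?_).const_mul _
    rw [norm_mul, norm_star, hμ, hμ, one_mul]
  have e1 : (∑ k, ∑ l, (V r k * star (V s k) * star (V r l * star (V s l))) *
        (if μ k * star (μ l) = 1 then 1 else 0))
      = ((∑ k, ‖V s k‖ ^ 2 * ‖V r k‖ ^ 2 : ℝ) : ℂ) := by
    push_cast
    refine Finset.sum_congr rfl fun k _ => ?_
    simp only [hone, mul_ite, mul_one, mul_zero, Finset.sum_ite_eq, Finset.mem_univ, if_true]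
    rw [← Complex.mul_conj', ← Complex.mul_conj']
    simp only [star_mul', Complex.star_def, Complex.conj_conj]
    ring
  rw [e1] at hlim
  have hre := (Complex.continuous_re.tendsto _).comp hlim
  rw [Complex.ofReal_re] at hre
  refine hre.congr fun T => ?_
  simp only [Function.comp_apply]
  rw [← Complex.ofReal_re ((1 / (T : ℝ)) * _)]
  congr 1
  push_cast
  simp_rw [← Complex.ofReal_pow, hsq]
  simp only [Finset.mul_sum]
  symm
  rw [Finset.sum_comm]
  refine Finset.sum_congr rfl fun k _ => ?_
  rw [Finset.sum_comm]
  exact Finset.sum_congr rfl fun l _ => Finset.sum_congr rfl fun t _ => by ring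

theorem star_dotProduct_eq_zero_of_eigenvalues_ne {m : Type*} [Fintype m] [DecidableEq m]
    {U : Matrix m m ℂ} (hU : Uᴴ * U = 1) {v w : m → ℂ} {μ ν : ℂ}
    (hv : U.mulVec v = μ • v) (hw : U.mulVec w = ν • w) (hμ : ‖μ‖ = 1) (h : μ ≠ ν) :
    star v ⬝ᵥ w = 0 := by
  have h1 : star (U.mulVec v) ⬝ᵥ U.mulVec w = star v ⬝ᵥ w := by
    rw [star_mulVec, ← dotProduct_mulVec, mulVec_mulVec, hU, one_mulVec]
  rw [hv, hw, star_smul, smul_dotProduct, dotProduct_smul, smul_eq_mul, smul_eq_mul,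
    ← mul_assoc] at h1
  by_contra h0
  have h2 : star μ * ν = 1 := mul_right_cancel₀ h0 (by rw [h1, one_mul])
  have h3 : μ * star μ = 1 := by
    rw [Complex.star_def, Complex.mul_conj', hμ]; norm_num
  apply h
  calc μ = μ * (star μ * ν) := by rw [h2, mul_one]
    _ = ν := by rw [← mul_assoc, h3, one_mul]

/-- A full set of eigenvectors with distinct eigenvalues of a unitary matrix determines the time
averaged transition probabilities, and is complete. -/
theorem tendsto_average_normSq_of_eigenvectors {m j : Type*} [Fintype m] [DecidableEq m]
    [Fintype j] [DecidableEq j] (hcard : Fintype.card m = Fintype.card j) {U : Matrix m m ℂ}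
    (hU : Uᴴ * U = 1) {w : j → m → ℂ} {μ : j → ℂ} {N : j → ℝ}
    (hw : ∀ k, U.mulVec (w k) = μ k • w k) (hμ : ∀ k, ‖μ k‖ = 1)
    (hinj : Function.Injective μ) (hN : ∀ k, 0 < N k) (hnorm : ∀ k, ∑ s, ‖w k s‖ ^ 2 = N k) :
    (∀ s r, Tendsto (fun T : ℕ => (1 / (T : ℝ)) *
        ∑ t ∈ Finset.range T, ‖((U ^ t).mulVec (Pi.single s 1)) r‖ ^ 2) atTop
      (𝓝 (∑ k, (‖w k s‖ ^ 2 / N k) * (‖w k r‖ ^ 2 / N k)))) ∧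
    ∀ s, ∑ k, ‖w k s‖ ^ 2 / N k = 1 := by
  set V : Matrix m j ℂ := Matrix.of fun s k => w k s / (Real.sqrt (N k) : ℂ) with hVdef
  have hVn : ∀ s k, ‖V s k‖ ^ 2 = ‖w k s‖ ^ 2 / N k := by
    intro s k
    simp only [hVdef, Matrix.of_apply, norm_div, Complex.norm_real, div_pow, Real.norm_eq_abs,
      sq_abs, Real.sq_sqrt (hN k).le]
  have h1 : Vᴴ * V = 1 := by
    ext k l
    rw [Matrix.mul_apply, Matrix.one_apply]
    have e : ∑ s, Vᴴ k s * V s l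
        = (star (w k) ⬝ᵥ w l) / ((Real.sqrt (N k) : ℂ) * (Real.sqrt (N l) : ℂ)) := by
      rw [dotProduct, Finset.sum_div]
      refine Finset.sum_congr rfl fun s _ => ?_
      simp only [hVdef, conjTranspose_apply, Matrix.of_apply, star_div₀, Pi.star_apply,
        Complex.star_def, Complex.conj_ofReal]
      rw [div_mul_div_comm]
    rw [e]
    split_ifs with hkl
    · subst hkl
      have : star (w k) ⬝ᵥ w k = (N k : ℂ) := by
        rw [← hnorm k, dotProduct]
        push_cast
        refine Finset.sum_congr rfl fun s _ => ?_
        rw [← Complex.conj_mul']; rfl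
      rw [this, ← Complex.ofReal_mul, Real.mul_self_sqrt (hN k).le, div_self]
      exact_mod_cast (hN k).ne'
    · rw [star_dotProduct_eq_zero_of_eigenvalues_ne hU (hw k) (hw l) (hμ k)
        (fun h => hkl (hinj h)), zero_div]
  -- Orthonormality becomes completeness because there are as many eigenvectors as basis states.
  have h2 : V * Vᴴ = 1 := (mul_eq_one_comm_of_card_eq _ _ _ hcard.symm).mp h1
  have h3 : U * V = V * diagonal μ := by
    ext s k
    rw [mul_diagonal, Matrix.mul_apply]
    have := congrFun (hw k) s
    simp only [mulVec, dotProduct, Pi.smul_apply, smul_eq_mul] at this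
    simp only [hVdef, Matrix.of_apply]
    simp_rw [← mul_div_assoc]
    rw [← Finset.sum_div, this]
    ring
  constructor
  · intro s r
    simpa only [hVn] using tendsto_average_normSq h2 h3 hμ hinj s r
  · intro s
    have := congrFun (congrFun h2 s) s
    rw [Matrix.mul_apply, Matrix.one_apply_eq] at this
    have h4 : ((∑ k, ‖V s k‖ ^ 2 : ℝ) : ℂ) = 1 := by
      rw [← this]
      push_cast
      refine Finset.sum_congr rfl fun k _ => ?_
      rw [← Complex.mul_conj']; rfl
    simp only [← hVn]
    exact_mod_cast h4

/-! ### Basis states as oriented edges, and unitarity of the walk. -/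

/-- The arc that leaves the left end of the edge `{e, e + 1}`. -/
def arcR {n : ℕ} (e : Fin (n + 1)) : Arc n :=
  ⟨(e.castSucc, Chirality.R), by simp, by simp [Fin.ext_iff]; omega⟩

/-- The arc that leaves the right end of the edge `{e, e + 1}`. -/
def arcL {n : ℕ} (e : Fin (n + 1)) : Arc n :=
  ⟨(e.succ, Chirality.L), by simp, by simp⟩

@[simp] theorem pos_arcR {n : ℕ} (e : Fin (n + 1)) : (arcR e).pos = e.castSucc := rfl
@[simp] theorem pos_arcL {n : ℕ} (e : Fin (n + 1)) : (arcL e).pos = e.succ := rfl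
@[simp] theorem chir_arcR {n : ℕ} (e : Fin (n + 1)) : (arcR e).chir = Chirality.R := rfl
@[simp] theorem chir_arcL {n : ℕ} (e : Fin (n + 1)) : (arcL e).chir = Chirality.L := rfl

theorem Arc.eq_arcR_or_arcL {n : ℕ} (s : Arc n) : (∃ e, s = arcR e) ∨ ∃ e, s = arcL e := by
  obtain ⟨⟨x, c⟩, h1, h2⟩ := s
  cases c with
  | R =>
    left
    have hx : x ≠ Fin.last (n + 1) := fun h => h2 ⟨h, rfl⟩
    exact ⟨x.castPred hx, by simp [arcR]⟩
  | L =>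
    right
    have hx : x ≠ 0 := fun h => h1 ⟨h, rfl⟩
    exact ⟨x.pred hx, by simp [arcL]⟩

theorem arcR_injective {n : ℕ} : Function.Injective (arcR (n := n)) := fun e f h => by
  simpa using congrArg Arc.pos h

theorem arcL_injective {n : ℕ} : Function.Injective (arcL (n := n)) := fun e f h => by
  simpa using congrArg Arc.pos h

theorem arcR_ne_arcL {n : ℕ} (e f : Fin (n + 1)) : arcR e ≠ arcL f := fun h => by
  simpa using congrArg Arc.chir h

/-- The basis states are the two orientations of the `n + 1` edges. -/
def arcEquiv (n : ℕ) : Fin (n + 1) ⊕ Fin (n + 1) ≃ Arc n :=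
  Equiv.ofBijective (Sum.elim arcR arcL)
    ⟨arcR_injective.sumElim arcL_injective arcR_ne_arcL, fun s => by
      rcases s.eq_arcR_or_arcL with ⟨e, rfl⟩ | ⟨e, rfl⟩
      · exact ⟨Sum.inl e, rfl⟩
      · exact ⟨Sum.inr e, rfl⟩⟩

theorem sum_arc {M : Type*} [AddCommMonoid M] {n : ℕ} (F : Arc n → M) :
    ∑ s, F s = ∑ e : Fin (n + 1), (F (arcR e) + F (arcL e)) := by
  rw [← (arcEquiv n).sum_comp, Fintype.sum_sum_type, ← Finset.sum_add_distrib]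
  rfl

theorem card_arc (n : ℕ) : Fintype.card (Arc n) = 2 * (n + 1) := by
  rw [← Fintype.card_congr (arcEquiv n), Fintype.card_sum, Fintype.card_fin]; ring

/-- The edge that an arc traverses, given by its left end. -/
def Arc.edge {n : ℕ} (s : Arc n) : Fin (n + 1) := Sum.elim id id ((arcEquiv n).symm s)

@[simp] theorem edge_arcR {n : ℕ} (e : Fin (n + 1)) : (arcR e).edge = e := by
  have : (arcEquiv n).symm (arcR e) = Sum.inl e := by rw [Equiv.symm_apply_eq]; rfl
  simp [Arc.edge, this]

@[simp] theorem edge_arcL {n : ℕ} (e : Fin (n + 1)) : (arcL e).edge = e := by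
  have : (arcEquiv n).symm (arcL e) = Sum.inr e := by rw [Equiv.symm_apply_eq]; rfl
  simp [Arc.edge, this]

theorem mulVec_arc {n : ℕ} (M : Matrix (Arc n) (Arc n) ℂ) (v : Arc n → ℂ) (t : Arc n) :
    M.mulVec v t = ∑ e, (M t (arcR e) * v (arcR e) + M t (arcL e) * v (arcL e)) := by
  rw [mulVec, dotProduct, sum_arc]

theorem shift_mulVec_arcL {n : ℕ} (v : Arc n → ℂ) (e : Fin (n + 1)) :
    (shift n).mulVec v (arcL e) = v (arcR e) := by
  rw [mulVec_arc]
  simp [shift, ← Fin.ext_iff]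

theorem shift_mulVec_arcR {n : ℕ} (v : Arc n → ℂ) (e : Fin (n + 1)) :
    (shift n).mulVec v (arcR e) = v (arcL e) := by
  rw [mulVec_arc]
  simp [shift, ← Fin.ext_iff]

theorem coin_mulVec_arcR_zero {p q : ℝ} {n : ℕ} (v : Arc n → ℂ) :
    (coin p q n).mulVec v (arcR 0) = v (arcR 0) := by
  rw [mulVec_arc, Finset.sum_eq_single 0]
  · simp [coin, -Fin.val_eq_zero_iff, Fin.ext_iff]
  · intro e _ he
    simp [coin, -Fin.val_eq_zero_iff, Fin.ext_iff] at he ⊢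
    exact fun h => absurd h.symm he
  · simp

theorem coin_mulVec_arcL_last {p q : ℝ} {n : ℕ} (v : Arc n → ℂ) :
    (coin p q n).mulVec v (arcL (Fin.last n)) = v (arcL (Fin.last n)) := by
  rw [mulVec_arc, Finset.sum_eq_single (Fin.last n)]
  · simp [coin, -Fin.val_eq_zero_iff, Fin.ext_iff]
  · intro e _ he
    simp [coin, -Fin.val_eq_zero_iff, Fin.ext_iff] at he ⊢
    have := e.is_lt
    rw [if_neg (by omega), if_neg (by omega), add_zero]
  · simp

theorem coin_mulVec_arcR_succ {p q : ℝ} (hp : 0 ≤ p) {n : ℕ} (v : Arc n → ℂ)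
    (e : Fin n) :
    (coin p q n).mulVec v (arcR e.succ) = (2 * p - 1) * v (arcR e.succ)
      + 2 * √p * √q * v (arcL e.castSucc) := by
  have h2 : ((√p : ℝ) : ℂ) * (√p : ℝ) = p := by
    rw [← Complex.ofReal_mul, Real.mul_self_sqrt hp]
  have hn := e.is_lt
  rw [mulVec_arc, Finset.sum_add_distrib, Finset.sum_eq_single e.succ,
    Finset.sum_eq_single e.castSucc]
  · have h3 : ((e : ℕ) = n) = False := by simp; omega
    simp [coin, -Fin.val_eq_zero_iff, Fin.ext_iff, phi, h3, mul_assoc, h2]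
  · intro f _ hf
    have h4 : ((e : ℕ) = f) = False := by
      simp [Fin.ext_iff] at hf ⊢; omega
    simp [coin, -Fin.val_eq_zero_iff, Fin.ext_iff, h4]
  · simp
  · intro f _ hf
    have h4 : ((e : ℕ) + 1 = f) = False := by
      simp [Fin.ext_iff] at hf ⊢; omega
    simp [coin, -Fin.val_eq_zero_iff, Fin.ext_iff, h4]
  · simp

theorem coin_mulVec_arcL_castSucc {p q : ℝ} (hq : 0 ≤ q) {n : ℕ} (v : Arc n → ℂ)
    (e : Fin n) :
    (coin p q n).mulVec v (arcL e.castSucc) = (2 * q - 1) * v (arcL e.castSucc)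
      + 2 * √p * √q * v (arcR e.succ) := by
  have h2 : ((√q : ℝ) : ℂ) * (√q : ℝ) = q := by
    rw [← Complex.ofReal_mul, Real.mul_self_sqrt hq]
  have hn := e.is_lt
  rw [mulVec_arc, Finset.sum_add_distrib, Finset.sum_eq_single e.succ,
    Finset.sum_eq_single e.castSucc, add_comm]
  · have h3 : ((e : ℕ) = n) = False := by simp; omega
    simp [coin, -Fin.val_eq_zero_iff, Fin.ext_iff, phi, h3, mul_assoc, h2]
    ring
  · intro f _ hf
    have h4 : ((e : ℕ) = f) = False := by
      simp [Fin.ext_iff] at hf ⊢; omega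
    simp [coin, -Fin.val_eq_zero_iff, Fin.ext_iff, h4]
  · simp
  · intro f _ hf
    have h4 : ((e : ℕ) + 1 = f) = False := by
      simp [Fin.ext_iff] at hf ⊢; omega
    simp [coin, -Fin.val_eq_zero_iff, Fin.ext_iff, h4]
  · simp

theorem eq_one_of_forall_mulVec {m : Type*} [Fintype m] [DecidableEq m] {M : Matrix m m ℂ}
    (h : ∀ v, M.mulVec v = v) : M = 1 :=
  ext_of_mulVec_single fun i => by rw [h, one_mulVec]

theorem shift_mul_shift (n : ℕ) : shift n * shift n = 1 := by
  refine eq_one_of_forall_mulVec fun v => funext fun s => ?_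
  rw [← mulVec_mulVec]
  rcases s.eq_arcR_or_arcL with ⟨e, rfl⟩ | ⟨e, rfl⟩
  · rw [shift_mulVec_arcR, shift_mulVec_arcL]
  · rw [shift_mulVec_arcL, shift_mulVec_arcR]

theorem coin_mul_coin {p q : ℝ} (hp : 0 ≤ p) (hq : 0 ≤ q) (hpq : p + q = 1) (n : ℕ) :
    coin p q n * coin p q n = 1 := by
  have hp2 : ((√p : ℝ) : ℂ) ^ 2 = p := by rw [← Complex.ofReal_pow, Real.sq_sqrt hp]
  have hq2 : ((√q : ℝ) : ℂ) ^ 2 = q := by rw [← Complex.ofReal_pow, Real.sq_sqrt hq]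
  have hpq' : (q : ℂ) = 1 - p := by
    rw [eq_sub_iff_add_eq, add_comm]; exact_mod_cast hpq
  refine eq_one_of_forall_mulVec fun v => funext fun s => ?_
  rw [← mulVec_mulVec]
  rcases s.eq_arcR_or_arcL with ⟨e, rfl⟩ | ⟨e, rfl⟩
  · refine Fin.cases ?_ (fun e => ?_) e
    · rw [coin_mulVec_arcR_zero, coin_mulVec_arcR_zero]
    · rw [coin_mulVec_arcR_succ hp, coin_mulVec_arcR_succ hp, coin_mulVec_arcL_castSucc hq]
      linear_combination (4 * (√q : ℂ) ^ 2 * v (arcR e.succ)) * hp2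
        + (4 * p * v (arcR e.succ)) * hq2
        + (4 * p * v (arcR e.succ) + 4 * √p * √q * v (arcL e.castSucc)) * hpq'
  · refine Fin.lastCases ?_ (fun e => ?_) e
    · rw [coin_mulVec_arcL_last, coin_mulVec_arcL_last]
    · rw [coin_mulVec_arcL_castSucc hq, coin_mulVec_arcR_succ hp, coin_mulVec_arcL_castSucc hq]
      linear_combination (4 * (√q : ℂ) ^ 2 * v (arcL e.castSucc)) * hp2
        + (4 * p * v (arcL e.castSucc)) * hq2
        + (4 * q * v (arcL e.castSucc) + 4 * √p * √q * v (arcR e.succ)) * hpq'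

theorem shift_conjTranspose (n : ℕ) : (shift n)ᴴ = shift n := by
  ext t s
  simp only [conjTranspose_apply, shift, Matrix.of_apply, apply_ite star, star_one, star_zero]
  refine if_congr ?_ rfl rfl
  constructor <;> (rintro (⟨h1, h2, h3⟩ | ⟨h1, h2, h3⟩))
  · exact Or.inr ⟨h2, h1, h3.symm⟩
  · exact Or.inl ⟨h2, h1, h3.symm⟩
  · exact Or.inr ⟨h2, h1, h3.symm⟩
  · exact Or.inl ⟨h2, h1, h3.symm⟩

theorem coin_conjTranspose (p q : ℝ) (n : ℕ) : (coin p q n)ᴴ = coin p q n := by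
  ext t s
  simp only [conjTranspose_apply, coin, Matrix.of_apply]
  by_cases h : t.pos = s.pos
  · rw [if_pos h, if_pos h.symm, h]
    rw [apply_ite star, star_one, Complex.star_def, Complex.conj_ofReal,
      mul_right_comm 2 (phi p q s.chir)]
    simp only [eq_comm (a := s.chir)]
  · rw [if_neg h, if_neg (Ne.symm h), star_zero]

theorem evolution_conjTranspose_mul {p q : ℝ} (hp : 0 ≤ p) (hq : 0 ≤ q) (hpq : p + q = 1)
    (n : ℕ) : (evolution p q n)ᴴ * evolution p q n = 1 := by
  rw [evolution, conjTranspose_mul, shift_conjTranspose, coin_conjTranspose, Matrix.mul_assoc,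
    ← Matrix.mul_assoc (shift n), shift_mul_shift, Matrix.one_mul, coin_mul_coin hp hq hpq]

theorem evolution_mulVec_arcL {p q : ℝ} {n : ℕ} (v : Arc n → ℂ) (e : Fin (n + 1)) :
    (evolution p q n).mulVec v (arcL e) = (coin p q n).mulVec v (arcR e) := by
  rw [evolution, ← mulVec_mulVec, shift_mulVec_arcL]

theorem evolution_mulVec_arcR {p q : ℝ} {n : ℕ} (v : Arc n → ℂ) (e : Fin (n + 1)) :
    (evolution p q n).mulVec v (arcR e) = (coin p q n).mulVec v (arcL e) := by
  rw [evolution, ← mulVec_mulVec, shift_mulVec_arcR]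

/-! ### Eigenvectors of the evolution operator. -/

/-- The vector with the components `f e` and `g e` on the two orientations of the edge `e`. -/
def arcVec {n : ℕ} (f g : ℕ → ℂ) : Arc n → ℂ := fun s =>
  if s.chir = Chirality.R then f s.edge else g s.edge

@[simp] theorem arcVec_arcR {n : ℕ} (f g : ℕ → ℂ) (e : Fin (n + 1)) :
    arcVec f g (arcR e) = f e := by simp [arcVec]

@[simp] theorem arcVec_arcL {n : ℕ} (f g : ℕ → ℂ) (e : Fin (n + 1)) :
    arcVec f g (arcL e) = g e := by simp [arcVec]

/-- The coin at the inner vertex `e + 1` mixes `arcR (e + 1)` with `arcL e`, and the shift then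
swaps the orientations of each edge. `h0` and `hn` are the equations at the two ends, where the coin
is trivial. -/
theorem evolution_mulVec_eq_smul {p q : ℝ} (hp : 0 ≤ p) (hq : 0 ≤ q) {n : ℕ} {f g : ℕ → ℂ}
    {μ : ℂ} (h0 : f 0 = μ * g 0)
    (hR : ∀ e, e < n → (2 * p - 1) * f (e + 1) + 2 * √p * √q * g e = μ * g (e + 1))
    (hL : ∀ e, e < n → (2 * q - 1) * g e + 2 * √p * √q * f (e + 1) = μ * f e)
    (hn : g n = μ * f n) :
    (evolution p q n).mulVec (arcVec f g) = μ • arcVec f g := by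
  funext s
  rw [Pi.smul_apply, smul_eq_mul]
  rcases s.eq_arcR_or_arcL with ⟨e, rfl⟩ | ⟨e, rfl⟩
  · rw [evolution_mulVec_arcR]
    refine Fin.lastCases ?_ (fun e => ?_) e
    · rw [coin_mulVec_arcL_last]; simpa using hn
    · rw [coin_mulVec_arcL_castSucc hq]; simpa using hL e e.is_lt
  · rw [evolution_mulVec_arcL]
    refine Fin.cases ?_ (fun e => ?_) e
    · rw [coin_mulVec_arcR_zero]; simpa using h0
    · rw [coin_mulVec_arcR_succ hp]; simpa using hR e e.is_lt

/-- The eigenvectors for the eigenvalues `±1`. -/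
theorem evolution_mulVec_geometric {p q : ℝ} (hp : 0 ≤ p) (hq : 0 < q) (hpq : p + q = 1)
    {n : ℕ} {σ : ℂ} (hσ : σ ^ 2 = 1) :
    (evolution p q n).mulVec
        (arcVec (fun e => (σ * (√p / √q)) ^ e) (fun e => σ * (σ * (√p / √q)) ^ e))
      = σ • arcVec (fun e => (σ * (√p / √q)) ^ e) (fun e => σ * (σ * (√p / √q)) ^ e) := by
  have hp2 : ((√p : ℝ) : ℂ) ^ 2 = p := by rw [← Complex.ofReal_pow, Real.sq_sqrt hp]
  have hq2 : ((√q : ℝ) : ℂ) ^ 2 = q := by rw [← Complex.ofReal_pow, Real.sq_sqrt hq.le]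
  have hb : ((√q : ℝ) : ℂ) ≠ 0 := by exact_mod_cast (Real.sqrt_pos.mpr hq).ne'
  have hpq' : (p : ℂ) + q = 1 := by exact_mod_cast hpq
  -- This ratio makes the amplitudes at each inner vertex proportional to `(√q, √p)`, so the coin
  -- fixes the vector, while the shift multiplies it by `σ`.
  have key : (√q : ℂ) * (σ * (√p / √q)) = σ * √p := by field_simp
  set z : ℂ := σ * (√p / √q) with hz
  refine evolution_mulVec_eq_smul hp hq.le ?_ ?_ ?_ ?_
  · linear_combination (-1 : ℂ) * hσ
  · intro e _
    linear_combination (-z ^ (e + 1)) * hσ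
      + (-2 * √q * z ^ e) * key + (2 * z ^ (e + 1)) * hq2 + (2 * z ^ (e + 1)) * hpq'
  · intro e _
    linear_combination (2 * √p * z ^ e) * key + (2 * σ * z ^ e) * hp2
      + (2 * σ * z ^ e) * hpq'
  · ring

/-- The eigenvectors that come from eigenvectors of the Jacobi matrix. -/
theorem evolution_mulVec_lift {p q : ℝ} (hp : 0 ≤ p) (hq : 0 ≤ q) (hpq : p + q = 1)
    {n : ℕ} {μ : ℂ} {l : ℝ} {g : ℕ → ℝ} (hμ : μ ^ 2 + 1 = 2 * l * μ)
    (h0 : l * √p * g 0 = √q * g 1) (hn : l * √q * g (n + 1) = √p * g n)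
    (hrec : ∀ e, √p * √q * (g e + g (e + 2)) = l * g (e + 1)) :
    (evolution p q n).mulVec
        (arcVec (fun e => √p * g e - μ * (√q * g (e + 1)))
          (fun e => √q * g (e + 1) - μ * (√p * g e)))
      = μ • arcVec (fun e => √p * g e - μ * (√q * g (e + 1)))
          (fun e => √q * g (e + 1) - μ * (√p * g e)) := by
  have hp2 : ((√p : ℝ) : ℂ) ^ 2 = p := by rw [← Complex.ofReal_pow, Real.sq_sqrt hp]
  have hq2 : ((√q : ℝ) : ℂ) ^ 2 = q := by rw [← Complex.ofReal_pow, Real.sq_sqrt hq]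
  have hpq' : (p : ℂ) + q = 1 := by exact_mod_cast hpq
  have h0' : (l : ℂ) * √p * g 0 = √q * g 1 := by exact_mod_cast h0
  have hn' : (l : ℂ) * √q * g (n + 1) = √p * g n := by exact_mod_cast hn
  have hrec' : ∀ e, (√p : ℂ) * √q * (g e + g (e + 2)) = l * g (e + 1) := fun e => by
    exact_mod_cast hrec e
  -- The vector is `a - μ S a`, where `a` has the components `√p g e` and `√q g (e + 1)` and is
  -- fixed by the coin `C`. The three equations for `g` say that `C S a = 2 l a - S a`; with `μ² + 1
  -- = 2 l μ` this gives the eigenvalue `μ`.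
  refine evolution_mulVec_eq_smul hp hq ?_ ?_ ?_ ?_
  · simp only [zero_add]
    linear_combination (√p * g 0 : ℂ) * hμ + 2 * μ * h0'
  · intro e _
    simp only [add_assoc, one_add_one_eq_two]
    linear_combination (-2 * μ * √p) * hrec' e + (√p * g (e + 1)) * hμ
      + (2 * √p * g (e + 1)) * hpq' + (2 * √p * g (e + 1)) * hq2
      + (2 * μ * √q * g (e + 2)) * hp2
  · intro e _
    simp only [add_assoc, one_add_one_eq_two]
    linear_combination (-2 * μ * √q) * hrec' e + (√q * g (e + 1)) * hμ
      + (2 * √q * g (e + 1)) * hpq' + (2 * √q * g (e + 1)) * hp2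
      + (2 * μ * √p * g e) * hq2
  · linear_combination (√q * g (n + 1) : ℂ) * hμ + 2 * μ * hn'

/-! ### Trigonometric eigenfunctions of the Jacobi matrix. -/

theorem sin_add_sin_add_two_mul (x φ : ℝ) :
    Real.sin x + Real.sin (x + 2 * φ) = 2 * Real.cos φ * Real.sin (x + φ) := by
  rw [Real.sin_add, Real.sin_add, Real.sin_two_mul, Real.cos_two_mul]; ring

theorem cos_add_cos_add_two_mul (x φ : ℝ) :
    Real.cos x + Real.cos (x + 2 * φ) = 2 * Real.cos φ * Real.cos (x + φ) := by
  rw [Real.cos_add, Real.cos_add, Real.sin_two_mul, Real.cos_two_mul]; ring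

/-- The eigenfunction of the Jacobi matrix at the angle `φ`. -/
def eigenfun (p q φ : ℝ) (x : ℕ) : ℝ :=
  (p - q) * Real.sin (x * φ) * Real.cos φ + Real.cos (x * φ) * Real.sin φ

/-- The oscillating part of the weight of an edge in the eigenstate at the angle `φ`. -/
def oscillation (p q φ : ℝ) (e : ℕ) : ℝ :=
  Real.sin φ * Real.sin ((2 * e + 1) * φ) - (p - q) * Real.cos φ * Real.cos ((2 * e + 1) * φ)

theorem eigenfun_recurrence (p q φ : ℝ) (e : ℕ) :
    eigenfun p q φ e + eigenfun p q φ (e + 2) = 2 * Real.cos φ * eigenfun p q φ (e + 1) := by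
  have h1 := sin_add_sin_add_two_mul (e * φ) φ
  have h2 := cos_add_cos_add_two_mul (e * φ) φ
  simp only [eigenfun]
  push_cast
  rw [show ((e : ℝ) + 2) * φ = e * φ + 2 * φ by ring, show ((e : ℝ) + 1) * φ = e * φ + φ by ring]
  linear_combination ((p - q) * Real.cos φ) * h1 + Real.sin φ * h2

/-- The left side is the squared modulus of either component of the lifted eigenvector on the edge
`e`, since its eigenvalue has real part `2√(pq) cos φ`. The right side separates a constant from an
oscillation in `e`. -/
theorem eigenfun_quadratic {p q : ℝ} (hpq : p + q = 1) (φ : ℝ) (e : ℕ) :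
    p * eigenfun p q φ e ^ 2 + q * eigenfun p q φ (e + 1) ^ 2
        - 4 * p * q * Real.cos φ * eigenfun p q φ e * eigenfun p q φ (e + 1)
      = (1 - 4 * p * q * Real.cos φ ^ 2) / 2 *
          ((1 - 4 * p * q * Real.cos φ ^ 2) + (p - q) * oscillation p q φ e) := by
  have hs := Real.sin_sq_add_cos_sq φ
  have hS := Real.sin_sq_add_cos_sq (e * φ)
  simp only [eigenfun, oscillation]
  push_cast
  rw [show (2 * (e : ℝ) + 1) * φ = 2 * (e * φ) + φ by ring,
    show ((e : ℝ) + 1) * φ = e * φ + φ by ring]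
  simp only [Real.sin_add, Real.cos_add, Real.sin_two_mul, Real.cos_two_mul']
  generalize Real.sin φ = s at *
  generalize Real.cos φ = c at *
  generalize Real.sin (e * φ) = S at *
  generalize Real.cos (e * φ) = C at *
  obtain rfl : q = 1 - p := by linarith
  grind

/-- Multiplication by `2 sin φ` makes the sum telescope to `2 sin² ((n + 1) φ)`; the cosine sum
below telescopes likewise to `sin (2 (n + 1) φ)`. -/
theorem sum_sin_odd_mul {n : ℕ} {φ : ℝ} (hφ : Real.sin φ ≠ 0)
    (h : Real.sin ((n + 1) * φ) = 0) :
    ∑ e ∈ Finset.range (n + 1), Real.sin ((2 * (e : ℝ) + 1) * φ) = 0 := by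
  have key : ∀ m : ℕ, 2 * Real.sin φ * ∑ e ∈ Finset.range m, Real.sin ((2 * (e : ℝ) + 1) * φ)
      = 1 - Real.cos (2 * (m * φ)) := by
    intro m
    induction m with
    | zero => simp
    | succ m ih =>
      rw [Finset.sum_range_succ, mul_add, ih]
      push_cast
      rw [show 2 * (((m : ℝ) + 1) * φ) = (2 * m + 1) * φ + φ by ring,
        show 2 * ((m : ℝ) * φ) = (2 * m + 1) * φ - φ by ring, Real.cos_add, Real.cos_sub]
      ring
  have h1 := key (n + 1)
  push_cast at h1
  rw [Real.cos_two_mul, Real.cos_sq', h] at h1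
  norm_num at h1
  simpa [hφ] using h1

theorem sum_cos_odd_mul {n : ℕ} {φ : ℝ} (hφ : Real.sin φ ≠ 0)
    (h : Real.sin ((n + 1) * φ) = 0) :
    ∑ e ∈ Finset.range (n + 1), Real.cos ((2 * (e : ℝ) + 1) * φ) = 0 := by
  have key : ∀ m : ℕ, 2 * Real.sin φ * ∑ e ∈ Finset.range m, Real.cos ((2 * (e : ℝ) + 1) * φ)
      = Real.sin (2 * (m * φ)) := by
    intro m
    induction m with
    | zero => simp
    | succ m ih =>
      rw [Finset.sum_range_succ, mul_add, ih]
      push_cast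
      rw [show 2 * (((m : ℝ) + 1) * φ) = (2 * m + 1) * φ + φ by ring,
        show 2 * ((m : ℝ) * φ) = (2 * m + 1) * φ - φ by ring, Real.sin_add, Real.sin_sub]
      ring
  have h1 := key (n + 1)
  push_cast at h1
  rw [Real.sin_two_mul, h] at h1
  simpa [hφ] using h1

theorem sum_oscillation {n : ℕ} {p q φ : ℝ} (hφ : Real.sin φ ≠ 0)
    (h : Real.sin ((n + 1) * φ) = 0) :
    ∑ e ∈ Finset.range (n + 1), oscillation p q φ e = 0 := by
  simp only [oscillation]
  rw [Finset.sum_sub_distrib, ← Finset.mul_sum, ← Finset.mul_sum, sum_sin_odd_mul hφ h,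
    sum_cos_odd_mul hφ h]
  ring

theorem eigenfun_zero (p q φ : ℝ) : eigenfun p q φ 0 = Real.sin φ := by simp [eigenfun]

/-- With `eigenfun_zero`, this is the boundary condition at the left end; it dictates the
coefficients of sine and cosine in `eigenfun`. -/
theorem eigenfun_one {p q : ℝ} (hpq : p + q = 1) (φ : ℝ) :
    eigenfun p q φ 1 = 2 * p * Real.sin φ * Real.cos φ := by
  simp only [eigenfun, Nat.cast_one, one_mul]
  linear_combination (-Real.sin φ * Real.cos φ) * hpq

/-- The boundary condition at the right end, which the quantization of the angle `φ` provides. -/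
theorem eigenfun_last {n : ℕ} {p q φ : ℝ} (hpq : p + q = 1) (h : Real.sin ((n + 1) * φ) = 0) :
    eigenfun p q φ n = 2 * q * Real.cos φ * eigenfun p q φ (n + 1) := by
  simp only [eigenfun]
  push_cast
  rw [show (n : ℝ) * φ = (n + 1) * φ - φ by ring, Real.sin_sub, Real.cos_sub, h]
  linear_combination (Real.cos φ * Real.cos ((n + 1) * φ) * Real.sin φ) * (-hpq)

/-! ### The full spectrum and the weights of the eigenstates. -/

/-- The angles `kπ / (n + 1)`. -/
def angle (n k : ℕ) : ℝ := k * Real.pi / (n + 1)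

/-- The square of the sine of the eigenphase that belongs to the angle `φ`. -/
def phaseSinSq (p q φ : ℝ) : ℝ := 1 - 4 * p * q * Real.cos φ ^ 2

/-- The sign that is selected by a Boolean. -/
def boolSign (b : Bool) : ℝ := if b then 1 else -1

theorem boolSign_sq (b : Bool) : boolSign b ^ 2 = 1 := by cases b <;> simp [boolSign]

theorem boolSign_ne_zero (b : Bool) : boolSign b ≠ 0 := by cases b <;> simp [boolSign]

theorem boolSign_injective : Function.Injective boolSign := by
  intro b c h
  cases b <;> cases c <;> simp [boolSign] at h ⊢ <;> norm_num at h

theorem abs_boolSign (b : Bool) : |boolSign b| = 1 := by cases b <;> simp [boolSign]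

theorem sin_last_mul_angle (n k : ℕ) : Real.sin ((n + 1) * angle n k) = 0 := by
  have : ((n : ℝ) + 1) * angle n k = k * Real.pi := by
    rw [angle]; field_simp
  rw [this, Real.sin_nat_mul_pi]

theorem angle_pos {n k : ℕ} (hk : 0 < k) : 0 < angle n k := by
  have : (0 : ℝ) < k := by exact_mod_cast hk
  have := Real.pi_pos
  rw [angle]; positivity

theorem angle_lt_pi {n k : ℕ} (hk : k < n + 1) : angle n k < Real.pi := by
  have : (k : ℝ) < n + 1 := by exact_mod_cast hk
  have := Real.pi_pos
  rw [angle, div_lt_iff₀ (by positivity), mul_comm]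
  gcongr

theorem sin_angle_pos {n k : ℕ} (hk : 0 < k) (hkn : k < n + 1) : 0 < Real.sin (angle n k) :=
  Real.sin_pos_of_pos_of_lt_pi (angle_pos hk) (angle_lt_pi hkn)

/-- Since `(p - q)² = 1 - 4pq`, the spectral gap from `±1` is bounded uniformly in `φ`. The bound
degenerates at `p = q`, so positivity is proved separately from `sin φ ≠ 0`. -/
theorem sq_sub_le_phaseSinSq {p q : ℝ} (hp : 0 < p) (hq : 0 < q) (hpq : p + q = 1) (φ : ℝ) :
    (p - q) ^ 2 ≤ phaseSinSq p q φ := by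
  have h1 : (p - q) ^ 2 = 1 - 4 * p * q := by
    linear_combination (p + q + 1) * hpq
  rw [h1, phaseSinSq]
  nlinarith [mul_nonneg (mul_pos hp hq).le (sub_nonneg.mpr (Real.cos_sq_le_one φ))]

theorem phaseSinSq_pos {p q φ : ℝ} (hp : 0 < p) (hq : 0 < q) (hpq : p + q = 1)
    (hφ : Real.sin φ ≠ 0) : 0 < phaseSinSq p q φ := by
  have h1 : phaseSinSq p q φ = (p - q) ^ 2 + 4 * (p * q) * Real.sin φ ^ 2 := by
    rw [phaseSinSq, Real.sin_sq]
    linear_combination -(p + q + 1) * hpq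
  have := mul_pos hp hq
  rw [h1]; positivity

/-- The eigenvalues of the evolution operator. -/
def eigenvalue (p q : ℝ) (n : ℕ) (j : Bool × Fin (n + 1)) : ℂ :=
  if j.2 = 0 then (boolSign j.1 : ℂ)
  else ⟨2 * √p * √q * Real.cos (angle n j.2), boolSign j.1 * √(phaseSinSq p q (angle n j.2))⟩

/-- The eigenvectors of the evolution operator. -/
def eigenvector (p q : ℝ) (n : ℕ) (j : Bool × Fin (n + 1)) : Arc n → ℂ :=
  if j.2 = 0 then
    arcVec (fun e => ((boolSign j.1 : ℂ) * (√p / √q)) ^ e)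
      (fun e => (boolSign j.1 : ℂ) * ((boolSign j.1 : ℂ) * (√p / √q)) ^ e)
  else
    arcVec (fun e => √p * eigenfun p q (angle n j.2) e
        - eigenvalue p q n j * (√q * eigenfun p q (angle n j.2) (e + 1)))
      (fun e => √q * eigenfun p q (angle n j.2) (e + 1)
        - eigenvalue p q n j * (√p * eigenfun p q (angle n j.2) e))

/-- The squared norms of the eigenvectors. -/
def eigenNorm (p q : ℝ) (n : ℕ) (k : Fin (n + 1)) : ℝ :=
  if k = 0 then 2 * ∑ e ∈ Finset.range (n + 1), (p / q) ^ e
  else (n + 1) * phaseSinSq p q (angle n k) ^ 2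

/-- The weight that the normalized eigenvectors number `k` give to each of the two orientations
of the edge `e`. -/
def edgeWeight (p q : ℝ) (n : ℕ) (k : Fin (n + 1)) (e : ℕ) : ℝ :=
  if k = 0 then (p / q) ^ e / (2 * ∑ j ∈ Finset.range (n + 1), (p / q) ^ j)
  else 1 / (2 * (n + 1)) *
    (1 + (p - q) * oscillation p q (angle n k) e / phaseSinSq p q (angle n k))

theorem sin_angle_ne_zero {n : ℕ} {k : Fin (n + 1)} (hk : k ≠ 0) :
    Real.sin (angle n k) ≠ 0 :=
  (sin_angle_pos (Nat.pos_of_ne_zero fun h => hk (Fin.ext h)) k.is_lt).ne'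

theorem norm_sq_eigenvalue {p q : ℝ} (hp : 0 < p) (hq : 0 < q) (hpq : p + q = 1) {n : ℕ}
    (j : Bool × Fin (n + 1)) : ‖eigenvalue p q n j‖ ^ 2 = 1 := by
  rw [eigenvalue]
  split_ifs with h
  · rw [Complex.norm_real, Real.norm_eq_abs, abs_boolSign]; norm_num
  · rw [Complex.sq_norm, Complex.normSq_mk]
    have h1 := Real.mul_self_sqrt (phaseSinSq_pos hp hq hpq (sin_angle_ne_zero h)).le
    have hp2 := Real.mul_self_sqrt hp.le
    have hq2 := Real.mul_self_sqrt hq.le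
    have h2 := boolSign_sq j.1
    rw [phaseSinSq] at h1 ⊢
    linear_combination h1 + (√(1 - 4 * p * q * Real.cos (angle n j.2) ^ 2) ^ 2) * h2
      + (4 * Real.cos (angle n j.2) ^ 2 * √q ^ 2) * hp2
      + (4 * Real.cos (angle n j.2) ^ 2 * p) * hq2

theorem norm_eigenvalue {p q : ℝ} (hp : 0 < p) (hq : 0 < q) (hpq : p + q = 1) {n : ℕ}
    (j : Bool × Fin (n + 1)) : ‖eigenvalue p q n j‖ = 1 := by
  have h := norm_sq_eigenvalue hp hq hpq j
  exact (pow_eq_one_iff_of_nonneg (norm_nonneg _) two_ne_zero).mp h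

/-- Only `±1` are real. Among the others the real part determines the angle, cosine being injective
on `[0, π]`, and the sign of the imaginary part determines the Boolean. -/
theorem eigenvalue_injective {p q : ℝ} (hp : 0 < p) (hq : 0 < q) (hpq : p + q = 1) (n : ℕ) :
    Function.Injective (eigenvalue p q n) := by
  have him : ∀ (b : Bool) (k : Fin (n + 1)), k ≠ 0 → (eigenvalue p q n (b, k)).im ≠ 0 := by
    intro b k hk
    simp only [eigenvalue, hk, if_false]
    exact mul_ne_zero (boolSign_ne_zero b)
      (Real.sqrt_pos.mpr (phaseSinSq_pos hp hq hpq (sin_angle_ne_zero hk))).ne'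
  have him0 : ∀ b : Bool, (eigenvalue p q n (b, 0)).im = 0 := by
    intro b; simp [eigenvalue]
  rintro ⟨b, k⟩ ⟨c, l⟩ h
  by_cases hk : k = 0
  · subst hk
    by_cases hl : l = 0
    · subst hl
      have h2 : boolSign b = boolSign c := by simpa [eigenvalue] using h
      rw [boolSign_injective h2]
    · exact absurd ((congrArg Complex.im h).symm.trans (him0 b)) (him c l hl)
  · by_cases hl : l = 0
    · subst hl
      exact absurd ((congrArg Complex.im h).trans (him0 c)) (him b k hk)
    · simp only [eigenvalue, hk, hl, if_false, Complex.mk.injEq] at h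
      have hab : 2 * √p * √q ≠ 0 := by positivity
      have hcos := mul_left_cancel₀ hab h.1
      have hang := Real.injOn_cos
        ⟨(angle_pos (Nat.pos_of_ne_zero fun h => hk (Fin.ext h))).le, (angle_lt_pi k.is_lt).le⟩
        ⟨(angle_pos (Nat.pos_of_ne_zero fun h => hl (Fin.ext h))).le, (angle_lt_pi l.is_lt).le⟩
        hcos
      have hkl : k = l := by
        have hn : (n : ℝ) + 1 ≠ 0 := by positivity
        have hpi := Real.pi_ne_zero
        simp only [angle] at hang
        field_simp at hang
        exact Fin.ext (by exact_mod_cast hang)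
      subst hkl
      have hs := mul_right_cancel₀
        (Real.sqrt_pos.mpr (phaseSinSq_pos hp hq hpq (sin_angle_ne_zero hk))).ne' h.2
      rw [boolSign_injective hs]

theorem eigenvector_spec {p q : ℝ} (hp : 0 < p) (hq : 0 < q) (hpq : p + q = 1) {n : ℕ}
    (j : Bool × Fin (n + 1)) :
    (evolution p q n).mulVec (eigenvector p q n j) = eigenvalue p q n j • eigenvector p q n j := by
  by_cases h : j.2 = 0
  · simp only [eigenvector, eigenvalue, h, if_true]
    exact evolution_mulVec_geometric hp.le hq hpq (by exact_mod_cast boolSign_sq j.1)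
  · simp only [eigenvector, h, if_false]
    have hp2 := Real.mul_self_sqrt hp.le
    have hq2 := Real.mul_self_sqrt hq.le
    refine evolution_mulVec_lift hp.le hq.le hpq
      (l := 2 * √p * √q * Real.cos (angle n j.2)) ?_ ?_ ?_ ?_
    · have hre : (eigenvalue p q n j).re = 2 * √p * √q * Real.cos (angle n j.2) := by
        simp [eigenvalue, h]
      rw [← hre]
      -- On the unit circle, `μ + μ⁻¹ = 2 Re μ`, which is the quadratic equation required of `μ`.
      have h1 : eigenvalue p q n j * starRingEnd ℂ (eigenvalue p q n j) = 1 := by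
        rw [Complex.mul_conj', norm_eigenvalue hp hq hpq]; norm_num
      have h2 := Complex.add_conj (eigenvalue p q n j)
      push_cast at h2
      linear_combination (eigenvalue p q n j) * h2 - h1
    · rw [eigenfun_zero, eigenfun_one hpq]
      linear_combination (2 * √q * Real.cos (angle n j.2) * Real.sin (angle n j.2)) * hp2
    · rw [eigenfun_last hpq (sin_last_mul_angle n j.2)]
      linear_combination
        (2 * √p * Real.cos (angle n j.2) * eigenfun p q (angle n j.2) (n + 1)) * hq2
    · intro e
      rw [eigenfun_recurrence]; ring

theorem norm_sq_ofReal_sub_mul {z : ℂ} (hz : ‖z‖ ^ 2 = 1) (x y : ℝ) :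
    ‖(x : ℂ) - z * y‖ ^ 2 = x ^ 2 + y ^ 2 - 2 * z.re * x * y := by
  rw [Complex.sq_norm, Complex.normSq_apply] at *
  simp
  linear_combination y ^ 2 * hz

theorem norm_sq_eigenvector {p q : ℝ} (hp : 0 < p) (hq : 0 < q) (hpq : p + q = 1) {n : ℕ}
    (j : Bool × Fin (n + 1)) (s : Arc n) :
    ‖eigenvector p q n j s‖ ^ 2 = eigenNorm p q n j.2 * edgeWeight p q n j.2 s.edge := by
  by_cases h : j.2 = 0
  · have hz : ‖((boolSign j.1 : ℂ) * (√p / √q))‖ ^ 2 = p / q := by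
      rw [norm_mul, Complex.norm_real, Real.norm_eq_abs, abs_boolSign, one_mul,
        ← Complex.ofReal_div, Complex.norm_real, Real.norm_eq_abs, sq_abs, div_pow,
        Real.sq_sqrt hp.le, Real.sq_sqrt hq.le]
    have hb : ‖(boolSign j.1 : ℂ)‖ ^ 2 = 1 := by
      rw [Complex.norm_real, Real.norm_eq_abs, abs_boolSign]; norm_num
    have hS : 2 * ∑ e ∈ Finset.range (n + 1), (p / q) ^ e ≠ 0 := by
      have : 0 < ∑ e ∈ Finset.range (n + 1), (p / q) ^ e :=
        Finset.sum_pos (fun _ _ => by positivity) ⟨0, by simp⟩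
      positivity
    simp only [eigenvector, eigenNorm, edgeWeight, h, if_true]
    rw [mul_div_cancel₀ _ hS]
    rcases s.eq_arcR_or_arcL with ⟨e, rfl⟩ | ⟨e, rfl⟩
    · rw [arcVec_arcR, norm_pow, pow_right_comm, hz, edge_arcR]
    · rw [arcVec_arcL, norm_mul, mul_pow, hb, one_mul, norm_pow, pow_right_comm, hz, edge_arcL]
  · have hpos := phaseSinSq_pos hp hq hpq (sin_angle_ne_zero h)
    have hre : (eigenvalue p q n j).re = 2 * √p * √q * Real.cos (angle n j.2) := by
      simp [eigenvalue, h]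
    have hz := norm_sq_eigenvalue hp hq hpq j
    have hp2 := Real.mul_self_sqrt hp.le
    have hq2 := Real.mul_self_sqrt hq.le
    have hn : (n : ℝ) + 1 ≠ 0 := by positivity
    have e1 : ∀ e : ℕ, (n + 1) * phaseSinSq p q (angle n j.2) ^ 2 * (1 / (2 * (n + 1)) *
        (1 + (p - q) * oscillation p q (angle n j.2) e / phaseSinSq p q (angle n j.2)))
        = p * eigenfun p q (angle n j.2) e ^ 2 + q * eigenfun p q (angle n j.2) (e + 1) ^ 2
        - 4 * p * q * Real.cos (angle n j.2) * eigenfun p q (angle n j.2) e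
          * eigenfun p q (angle n j.2) (e + 1) := by
      intro e
      rw [eigenfun_quadratic hpq]
      change _ = phaseSinSq p q (angle n j.2) / 2 * (phaseSinSq p q (angle n j.2) + _)
      field_simp
    simp only [eigenvector, eigenNorm, edgeWeight, h, if_false]
    rcases s.eq_arcR_or_arcL with ⟨e, rfl⟩ | ⟨e, rfl⟩
    · rw [arcVec_arcR, edge_arcR, e1, ← Complex.ofReal_mul, ← Complex.ofReal_mul,
        norm_sq_ofReal_sub_mul hz, hre]
      generalize eigenfun p q (angle n j.2) e = x
      generalize eigenfun p q (angle n j.2) (e + 1) = y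
      generalize Real.cos (angle n j.2) = c
      linear_combination (x ^ 2 - 4 * c * x * y * √q * √q) * hp2 + (y ^ 2 - 4 * c * x * y * p) * hq2
    · rw [arcVec_arcL, edge_arcL, e1, ← Complex.ofReal_mul, ← Complex.ofReal_mul,
        norm_sq_ofReal_sub_mul hz, hre]
      generalize eigenfun p q (angle n j.2) e = x
      generalize eigenfun p q (angle n j.2) (e + 1) = y
      generalize Real.cos (angle n j.2) = c
      linear_combination (x ^ 2 - 4 * c * x * y * √q * √q) * hp2 + (y ^ 2 - 4 * c * x * y * p) * hq2

/-- The total is one half because each edge carries two arcs; the oscillating parts cancel over the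
path. -/
theorem sum_edgeWeight {p q : ℝ} (hp : 0 < p) (hq : 0 < q) {n : ℕ}
    (k : Fin (n + 1)) : ∑ e ∈ Finset.range (n + 1), edgeWeight p q n k e = 1 / 2 := by
  by_cases h : k = 0
  · have : 0 < ∑ e ∈ Finset.range (n + 1), (p / q) ^ e :=
      Finset.sum_pos (fun _ _ => by positivity) ⟨0, by simp⟩
    simp only [edgeWeight, h, if_true]
    rw [← Finset.sum_div]
    field_simp
  · simp only [edgeWeight, h, if_false]
    rw [← Finset.mul_sum, Finset.sum_add_distrib, ← Finset.sum_div, ← Finset.mul_sum,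
      sum_oscillation (sin_angle_ne_zero h) (sin_last_mul_angle n k)]
    have hn : (n : ℝ) + 1 ≠ 0 := by positivity
    simp
    field_simp

theorem eigenNorm_pos {p q : ℝ} (hp : 0 < p) (hq : 0 < q) (hpq : p + q = 1) {n : ℕ}
    (k : Fin (n + 1)) : 0 < eigenNorm p q n k := by
  rw [eigenNorm]
  split_ifs with h
  · have : 0 < ∑ e ∈ Finset.range (n + 1), (p / q) ^ e :=
      Finset.sum_pos (fun _ _ => by positivity) ⟨0, by simp⟩
    positivity
  · have hpos := phaseSinSq_pos hp hq hpq (sin_angle_ne_zero h)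
    positivity

theorem sum_norm_sq_eigenvector {p q : ℝ} (hp : 0 < p) (hq : 0 < q) (hpq : p + q = 1) {n : ℕ}
    (j : Bool × Fin (n + 1)) : ∑ s, ‖eigenvector p q n j s‖ ^ 2 = eigenNorm p q n j.2 := by
  simp only [norm_sq_eigenvector hp hq hpq]
  rw [← Finset.mul_sum, sum_arc]
  simp only [edge_arcR, edge_arcL, ← two_mul]
  rw [← Finset.mul_sum, Fin.sum_univ_eq_sum_range, sum_edgeWeight hp hq]
  ring

/-- The time averaged transition probabilities between basis states. -/
theorem tendsto_average_evolution {p q : ℝ} (hp : 0 < p) (hq : 0 < q) (hpq : p + q = 1) {n : ℕ}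
    (s r : Arc n) :
    Tendsto (fun T : ℕ => (1 / (T : ℝ)) *
        ∑ t ∈ Finset.range T, ‖((evolution p q n ^ t).mulVec (Pi.single s 1)) r‖ ^ 2) atTop
      (𝓝 (2 * ∑ k, edgeWeight p q n k s.edge * edgeWeight p q n k r.edge)) ∧
    2 * ∑ k, edgeWeight p q n k s.edge = 1 := by
  have hcard : Fintype.card (Arc n) = Fintype.card (Bool × Fin (n + 1)) := by
    rw [card_arc, Fintype.card_prod, Fintype.card_bool, Fintype.card_fin]
  have hw : ∀ (j : Bool × Fin (n + 1)) (u : Arc n),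
      ‖eigenvector p q n j u‖ ^ 2 / eigenNorm p q n j.2 = edgeWeight p q n j.2 u.edge := by
    intro j u
    rw [norm_sq_eigenvector hp hq hpq, mul_div_cancel_left₀ _ (eigenNorm_pos hp hq hpq j.2).ne']
  obtain ⟨h1, h2⟩ := tendsto_average_normSq_of_eigenvectors hcard
    (evolution_conjTranspose_mul hp.le hq.le hpq n) (eigenvector_spec hp hq hpq)
    (norm_eigenvalue hp hq hpq) (eigenvalue_injective hp hq hpq n)
    (fun j => eigenNorm_pos hp hq hpq j.2) (sum_norm_sq_eigenvector hp hq hpq)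
  simp only [hw, Fintype.sum_prod_type, Fintype.sum_bool, ← two_mul] at h1 h2
  exact ⟨h1 s r, h2 s⟩

/-! ### The time averaged law in terms of edge weights. -/

theorem startStates_nonempty {n : ℕ} (i : Fin (n + 2)) : (startStates n i).Nonempty := by
  refine Fin.lastCases ?_ (fun e => ?_) i
  · exact ⟨arcL (Fin.last n), by simp [startStates]⟩
  · exact ⟨arcR e, by simp [startStates]⟩

theorem card_startStates_pos {n : ℕ} (i : Fin (n + 2)) : (0 : ℝ) < (startStates n i).card := by
  exact_mod_cast (startStates_nonempty i).card_pos

/-- The sign is not visible in the formula; it comes from the interpretation as a normalized squared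
modulus. -/
theorem edgeWeight_nonneg {p q : ℝ} (hp : 0 < p) (hq : 0 < q) (hpq : p + q = 1) {n : ℕ}
    (k e : Fin (n + 1)) : 0 ≤ edgeWeight p q n k e := by
  have h := norm_sq_eigenvector hp hq hpq (true, k) (arcR e)
  rw [edge_arcR] at h
  have h1 : 0 ≤ eigenNorm p q n k * edgeWeight p q n k e := by rw [← h]; positivity
  exact nonneg_of_mul_nonneg_right h1 (eigenNorm_pos hp hq hpq k)

theorem tendsto_finiteTimeAverage {p q : ℝ} (hp : 0 < p) (hq : 0 < q) (hpq : p + q = 1) {n : ℕ}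
    (i x : Fin (n + 2)) :
    Tendsto (finiteTimeAverage p q n i x) atTop
      (𝓝 ((∑ s ∈ startStates n i, ∑ r : Arc n with r.pos = x,
        2 * ∑ k, edgeWeight p q n k s.edge * edgeWeight p q n k r.edge) /
          ((startStates n i).card : ℝ))) := by
  unfold finiteTimeAverage
  refine (tendsto_finsetSum _ fun s _ => ?_).div_const _
  have h := tendsto_finsetSum (Finset.univ.filter fun r : Arc n => r.pos = x)
    fun r _ => (tendsto_average_evolution hp hq hpq s r).1
  refine h.congr fun T => ?_
  simp only [prob]
  rw [← Finset.mul_sum, Finset.sum_comm]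

theorem timeAveraged_eq {p q : ℝ} (hp : 0 < p) (hq : 0 < q) (hpq : p + q = 1) {n : ℕ}
    (i x : Fin (n + 2)) :
    timeAveraged p q n i x = (∑ s ∈ startStates n i, ∑ r : Arc n with r.pos = x,
        2 * ∑ k, edgeWeight p q n k s.edge * edgeWeight p q n k r.edge) /
          ((startStates n i).card : ℝ) :=
  (tendsto_finiteTimeAverage hp hq hpq i x).limUnder_eq

theorem timeAveraged_nonneg {p q : ℝ} (hp : 0 < p) (hq : 0 < q) (hpq : p + q = 1) {n : ℕ}
    (i x : Fin (n + 2)) : 0 ≤ timeAveraged p q n i x := by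
  rw [timeAveraged_eq hp hq hpq]
  refine div_nonneg (Finset.sum_nonneg fun s _ => Finset.sum_nonneg fun r _ => ?_)
    (card_startStates_pos i).le
  exact mul_nonneg zero_le_two (Finset.sum_nonneg fun k _ =>
    mul_nonneg (edgeWeight_nonneg hp hq hpq _ _) (edgeWeight_nonneg hp hq hpq _ _))

/-- The mean of `F (x / n)` in the eigenstates number `k`, where `x` is a vertex. -/
def eigenMean (p q : ℝ) (n : ℕ) (F : ℝ → ℝ) (k : Fin (n + 1)) : ℝ :=
  ∑ e ∈ Finset.range (n + 1), edgeWeight p q n k e * (F (e / n) + F ((e + 1) / n))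

/-- The mean of `F (X / n)` for the walk that starts from an orientation of the edge `e`. -/
def edgeMean (p q : ℝ) (n : ℕ) (F : ℝ → ℝ) (e : ℕ) : ℝ :=
  2 * ∑ k, edgeWeight p q n k e * eigenMean p q n F k

/-- Summing over vertices and then over the arcs at each vertex is summing over all arcs. The two
arcs of the edge `e` sit at `e` and `e + 1`, whence the two values of `F` in `eigenMean`. -/
theorem sum_timeAveraged_mul {p q : ℝ} (hp : 0 < p) (hq : 0 < q) (hpq : p + q = 1) {n : ℕ}
    (i : Fin (n + 2)) (F : ℝ → ℝ) :
    ∑ x, timeAveraged p q n i x * F ((x : ℕ) / n)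
      = (∑ s ∈ startStates n i, edgeMean p q n F s.edge) / ((startStates n i).card : ℝ) := by
  simp only [timeAveraged_eq hp hq hpq]
  simp only [div_mul_eq_mul_div]
  rw [← Finset.sum_div]
  congr 1
  simp only [Finset.sum_mul]
  rw [Finset.sum_comm]
  refine Finset.sum_congr rfl fun s _ => ?_
  have h1 : ∀ x : Fin (n + 2), (∑ r : Arc n with r.pos = x,
      (2 * ∑ k, edgeWeight p q n k s.edge * edgeWeight p q n k r.edge) * F ((x : ℕ) / n))
      = ∑ r : Arc n with r.pos = x,
      (2 * ∑ k, edgeWeight p q n k s.edge * edgeWeight p q n k r.edge)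
        * F (((r.pos : Fin (n + 2)) : ℕ) / n) := by
    intro x
    refine Finset.sum_congr rfl fun r hr => ?_
    rw [(Finset.mem_filter.mp hr).2]
  simp only [h1]
  rw [Finset.sum_fiberwise, sum_arc]
  simp only [edge_arcR, edge_arcL, pos_arcR, pos_arcL, edgeMean, eigenMean, Fin.val_castSucc,
    Fin.val_succ, ← mul_add]
  simp only [Finset.mul_sum, Finset.sum_mul]
  rw [Finset.sum_comm]
  refine Finset.sum_congr rfl fun k _ => ?_
  rw [Finset.sum_range]
  refine Finset.sum_congr rfl fun e _ => ?_
  push_cast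
  ring

/-- Completeness of the eigenvectors at one basis state; the factor 2 counts the two signs. -/
theorem two_mul_sum_edgeWeight {p q : ℝ} (hp : 0 < p) (hq : 0 < q) (hpq : p + q = 1) {n : ℕ}
    (e : Fin (n + 1)) : 2 * ∑ k, edgeWeight p q n k e = 1 := by
  simpa using (tendsto_average_evolution hp hq hpq (arcR e) (arcR e)).2

theorem sum_timeAveraged {p q : ℝ} (hp : 0 < p) (hq : 0 < q) (hpq : p + q = 1) {n : ℕ}
    (i : Fin (n + 2)) : ∑ x, timeAveraged p q n i x = 1 := by
  have h := sum_timeAveraged_mul hp hq hpq i (fun _ => 1)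
  simp only [mul_one] at h
  have h1 : ∀ k : Fin (n + 1), eigenMean p q n (fun _ => 1) k = 1 := by
    intro k
    rw [eigenMean, ← Finset.sum_mul, sum_edgeWeight hp hq]; norm_num
  have h2 : ∀ e : Fin (n + 1), edgeMean p q n (fun _ => 1) e = 1 := by
    intro e
    simp only [edgeMean, h1, mul_one]
    exact two_mul_sum_edgeWeight hp hq hpq e
  rw [h]
  simp only [h2, Finset.sum_const, nsmul_eq_mul, mul_one]
  exact div_self (card_startStates_pos i).ne'

theorem isProbabilityMeasure_scaledLaw {p q : ℝ} (hp : 0 < p) (hq : 0 < q) (hpq : p + q = 1)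
    {n : ℕ} (i : Fin (n + 2)) : IsProbabilityMeasure (scaledLaw p q n i) := by
  constructor
  simp only [scaledLaw, Measure.finsetSum_apply, Measure.smul_apply, measure_univ, smul_eq_mul,
    mul_one]
  rw [← ENNReal.ofReal_sum_of_nonneg fun x _ => timeAveraged_nonneg hp hq hpq i x,
    sum_timeAveraged hp hq hpq, ENNReal.ofReal_one]

theorem integral_scaledLaw {p q : ℝ} (hp : 0 < p) (hq : 0 < q) (hpq : p + q = 1) {n : ℕ}
    (i : Fin (n + 2)) (F : ℝ → ℝ) :
    ∫ y, F y ∂scaledLaw p q n i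
      = (∑ s ∈ startStates n i, edgeMean p q n F s.edge) / ((startStates n i).card : ℝ) := by
  rw [← sum_timeAveraged_mul hp hq hpq, scaledLaw, integral_finsetSum_measure]
  · refine Finset.sum_congr rfl fun x _ => ?_
    rw [integral_smul_measure, integral_dirac, ENNReal.toReal_ofReal
      (timeAveraged_nonneg hp hq hpq i x), smul_eq_mul]
  · intro x _
    exact (integrable_dirac (by simp)).smul_measure ENNReal.ofReal_ne_top

/-! ### Discrete Parseval identity and the error estimate. -/

theorem sum_cos_two_mul_angle {n : ℕ} (e f : ℕ) (he : e < n + 1) (hf : f < n + 1) :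
    ∑ k ∈ Finset.range (n + 1), Real.cos ((2 * e + 1) * angle n k - (2 * f + 1) * angle n k)
      = if e = f then (n + 1 : ℝ) else 0 := by
  split_ifs with h
  · subst h; simp
  · set θ : ℝ := ((e : ℝ) - f) * Real.pi / (n + 1) with hθ
    have hn : (0 : ℝ) < n + 1 := by positivity
    have he' : (e : ℝ) < n + 1 := by exact_mod_cast he
    have hf' : (f : ℝ) < n + 1 := by exact_mod_cast hf
    have he0 : (0 : ℝ) ≤ e := by positivity
    have hf0 : (0 : ℝ) ≤ f := by positivity
    have hpi := Real.pi_pos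
    have hsin : Real.sin θ ≠ 0 := by
      rw [Ne, Real.sin_eq_zero_iff_of_lt_of_lt]
      · rw [hθ, div_eq_zero_iff, mul_eq_zero, sub_eq_zero]
        rintro ((h1 | h1) | h1)
        · exact h (by exact_mod_cast h1)
        · exact hpi.ne' h1
        · exact hn.ne' h1
      · rw [hθ, lt_div_iff₀ hn]; nlinarith
      · rw [hθ, div_lt_iff₀ hn]; nlinarith
    have key : ∀ m : ℕ, 2 * Real.sin θ * ∑ k ∈ Finset.range m, Real.cos (2 * (k * θ))
        = Real.sin (2 * (m * θ) - θ) + Real.sin θ := by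
      intro m
      induction m with
      | zero => simp
      | succ m ih =>
        rw [Finset.sum_range_succ, mul_add, ih]
        push_cast
        rw [show 2 * (((m : ℝ) + 1) * θ) - θ = 2 * (m * θ) + θ by ring, Real.sin_add,
          Real.sin_sub]
        ring
    have h1 := key (n + 1)
    have h2 : 2 * (((n + 1 : ℕ) : ℝ) * θ) - θ = ((e - f : ℤ) : ℝ) * (2 * Real.pi) - θ := by
      rw [hθ]; push_cast; field_simp
    rw [h2, Real.sin_int_mul_two_pi_sub, neg_add_cancel] at h1
    have h3 := (mul_eq_zero.mp h1).resolve_left (mul_ne_zero two_ne_zero hsin)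
    rw [← h3]
    refine Finset.sum_congr rfl fun k _ => ?_
    congr 1
    rw [hθ, angle]
    field_simp
    ring

/-- Adding the sine and cosine squares leaves only cosines of differences of angles, to which the
orthogonality relation applies. -/
theorem sum_sq_add_sum_sq {n : ℕ} (G : ℕ → ℝ) :
    ∑ k ∈ Finset.range (n + 1),
      ((∑ e ∈ Finset.range (n + 1), Real.sin ((2 * e + 1) * angle n k) * G e) ^ 2
      + (∑ e ∈ Finset.range (n + 1), Real.cos ((2 * e + 1) * angle n k) * G e) ^ 2)
      = (n + 1) * ∑ e ∈ Finset.range (n + 1), G e ^ 2 := by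
  have h1 : ∀ k : ℕ,
      (∑ e ∈ Finset.range (n + 1), Real.sin ((2 * e + 1) * angle n k) * G e) ^ 2
      + (∑ e ∈ Finset.range (n + 1), Real.cos ((2 * e + 1) * angle n k) * G e) ^ 2
      = ∑ e ∈ Finset.range (n + 1), ∑ f ∈ Finset.range (n + 1), G e * G f *
        Real.cos ((2 * e + 1) * angle n k - (2 * f + 1) * angle n k) := by
    intro k
    rw [sq, sq, Finset.sum_mul_sum, Finset.sum_mul_sum, ← Finset.sum_add_distrib]
    refine Finset.sum_congr rfl fun e _ => ?_
    rw [← Finset.sum_add_distrib]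
    refine Finset.sum_congr rfl fun f _ => ?_
    rw [Real.cos_sub]; ring
  simp only [h1]
  rw [Finset.sum_comm, Finset.mul_sum]
  refine Finset.sum_congr rfl fun e he => ?_
  rw [Finset.sum_comm]
  have h2 : ∀ f ∈ Finset.range (n + 1), ∑ k ∈ Finset.range (n + 1), G e * G f *
        Real.cos ((2 * e + 1) * angle n k - (2 * f + 1) * angle n k)
        = if e = f then (n + 1) * G e ^ 2 else 0 := by
    intro f hf
    rw [← Finset.mul_sum,
      sum_cos_two_mul_angle e f (Finset.mem_range.mp he) (Finset.mem_range.mp hf)]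
    split_ifs with h
    · subst h; ring
    · ring
  rw [Finset.sum_congr rfl h2, Finset.sum_ite_eq, if_pos he]

/-- For each `k`, the oscillation pairs the sine and cosine coefficients with `(sin φ, -(p - q) cos
φ)`, a vector of norm at most one; Cauchy–Schwarz and Parseval finish. -/
theorem sum_sq_sum_oscillation_le {p q : ℝ} (hD : (p - q) ^ 2 ≤ 1) {n : ℕ} (G : ℕ → ℝ) :
    ∑ k ∈ Finset.range (n + 1),
      (∑ e ∈ Finset.range (n + 1), oscillation p q (angle n k) e * G e) ^ 2
      ≤ (n + 1) * ∑ e ∈ Finset.range (n + 1), G e ^ 2 := by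
  rw [← sum_sq_add_sum_sq]
  refine Finset.sum_le_sum fun k _ => ?_
  have h1 : ∑ e ∈ Finset.range (n + 1), oscillation p q (angle n k) e * G e
      = Real.sin (angle n k) *
          ∑ e ∈ Finset.range (n + 1), Real.sin ((2 * e + 1) * angle n k) * G e
        - (p - q) * Real.cos (angle n k) *
          ∑ e ∈ Finset.range (n + 1), Real.cos ((2 * e + 1) * angle n k) * G e := by
    rw [Finset.mul_sum, Finset.mul_sum, ← Finset.sum_sub_distrib]
    refine Finset.sum_congr rfl fun e _ => ?_
    rw [oscillation]; ring
  rw [h1]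
  have hsc := Real.sin_sq_add_cos_sq (angle n k)
  generalize ∑ e ∈ Finset.range (n + 1), Real.sin ((2 * e + 1) * angle n k) * G e = A
  generalize ∑ e ∈ Finset.range (n + 1), Real.cos ((2 * e + 1) * angle n k) * G e = B
  generalize Real.sin (angle n k) = s at *
  generalize Real.cos (angle n k) = c at *
  have h2 : s ^ 2 + ((p - q) * c) ^ 2 ≤ 1 := by
    rw [mul_pow, ← hsc]
    nlinarith [mul_le_mul_of_nonneg_right hD (sq_nonneg c)]
  have h3 : (s * A - (p - q) * c * B) ^ 2 ≤ (s ^ 2 + ((p - q) * c) ^ 2) * (A ^ 2 + B ^ 2) := by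
    nlinarith [sq_nonneg (s * B + (p - q) * c * A)]
  nlinarith [sq_nonneg A, sq_nonneg B]

theorem abs_oscillation_le_one {p q : ℝ} (hD : (p - q) ^ 2 ≤ 1) (φ : ℝ) (e : ℕ) :
    |oscillation p q φ e| ≤ 1 := by
  rw [← sq_le_one_iff_abs_le_one, oscillation]
  have h1 := Real.sin_sq_add_cos_sq φ
  have h2 := Real.sin_sq_add_cos_sq ((2 * e + 1) * φ)
  generalize Real.sin φ = s at *
  generalize Real.cos φ = c at *
  generalize Real.sin ((2 * e + 1) * φ) = S at *
  generalize Real.cos ((2 * e + 1) * φ) = C at *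
  have h3 : s ^ 2 + ((p - q) * c) ^ 2 ≤ 1 := by
    rw [mul_pow, ← h1]
    nlinarith [mul_le_mul_of_nonneg_right hD (sq_nonneg c)]
  have h4 : (s * S - (p - q) * c * C) ^ 2 ≤ (s ^ 2 + ((p - q) * c) ^ 2) * (S ^ 2 + C ^ 2) := by
    nlinarith [sq_nonneg (s * C + (p - q) * c * S)]
  rw [h2, mul_one] at h4
  exact h4.trans h3

/-- The mean of `F (x / n)` when both orientations of all edges have the same weight. -/
def flatMean (n : ℕ) (F : ℝ → ℝ) : ℝ :=
  1 / (2 * (n + 1)) * ∑ e ∈ Finset.range (n + 1), (F (e / n) + F ((e + 1) / n))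

theorem eigenMean_of_ne_zero {p q : ℝ} {n : ℕ} (F : ℝ → ℝ) {k : Fin (n + 1)} (hk : k ≠ 0) :
    eigenMean p q n F k = flatMean n F + 1 / (2 * (n + 1)) *
      ((p - q) / phaseSinSq p q (angle n k) * ∑ e ∈ Finset.range (n + 1),
        oscillation p q (angle n k) e * (F (e / n) + F ((e + 1) / n))) := by
  rw [eigenMean, flatMean, ← mul_add, Finset.mul_sum, ← Finset.sum_add_distrib, Finset.mul_sum]
  refine Finset.sum_congr rfl fun e _ => ?_
  simp only [edgeWeight, hk, if_false]
  ring

/-- At `p = q` both sides are `0`, by the convention `1 / 0 = 0`. This is the right value: all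
weights with `k ≠ 0` are then exactly flat. -/
theorem abs_sub_div_phaseSinSq_le {p q : ℝ} (hp : 0 < p) (hq : 0 < q) (hpq : p + q = 1) (φ : ℝ) :
    |(p - q) / phaseSinSq p q φ| ≤ 1 / |p - q| := by
  by_cases hD : p - q = 0
  · simp [hD]
  · have h1 := sq_sub_le_phaseSinSq hp hq hpq φ
    have h0 : 0 < |p - q| := abs_pos.mpr hD
    have h2 : 0 < (p - q) ^ 2 := by positivity
    rw [abs_div, abs_of_pos (h2.trans_le h1), div_le_div_iff₀ (h2.trans_le h1) h0, one_mul,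
      ← sq, sq_abs]
    exact h1

/-- Up to a small error, the walk is a mixture of the stationary state and the flat state. -/
theorem abs_edgeMean_sub_le {p q : ℝ} (hp : 0 < p) (hq : 0 < q) (hpq : p + q = 1) {n : ℕ}
    {F : ℝ → ℝ} {B : ℝ} (hF : ∀ x, |F x| ≤ B) (e : Fin (n + 1)) :
    |edgeMean p q n F e - (2 * edgeWeight p q n 0 e * eigenMean p q n F 0
        + (1 - 2 * edgeWeight p q n 0 e) * flatMean n F)|
      ≤ √((B * ((1 + 1 / |p - q|) * (1 / |p - q|))) ^ 2 / (n + 1)) := by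
  set D : ℝ := 1 / |p - q| with hDdef
  have hD0 : 0 ≤ D := by positivity
  have hB : 0 ≤ B := (abs_nonneg _).trans (hF 0)
  have hn : (0 : ℝ) < n + 1 := by positivity
  have hD1 : (p - q) ^ 2 ≤ 1 := by nlinarith
  set G : ℕ → ℝ := fun e => F (e / n) + F ((e + 1) / n) with hG
  set T : ℕ → ℝ := fun k => ∑ e ∈ Finset.range (n + 1), oscillation p q (angle n k) e * G e
    with hT
  -- As the doubled weights at `e` sum to one over `k`, `flatMean` can be subtracted inside the sum;
  -- the term `k = 0` is then split off.
  have h1 : edgeMean p q n F e - (2 * edgeWeight p q n 0 e * eigenMean p q n F 0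
        + (1 - 2 * edgeWeight p q n 0 e) * flatMean n F)
      = ∑ k ∈ Finset.univ.erase (0 : Fin (n + 1)),
        2 * edgeWeight p q n k e * (eigenMean p q n F k - flatMean n F) := by
    have hs := two_mul_sum_edgeWeight hp hq hpq e
    have h2 : ∑ k : Fin (n + 1), 2 * edgeWeight p q n k e * (eigenMean p q n F k - flatMean n F)
        = edgeMean p q n F e - flatMean n F := by
      rw [edgeMean]
      have : flatMean n F = (2 * ∑ k : Fin (n + 1), edgeWeight p q n k e) * flatMean n F := by
        rw [hs, one_mul]
      conv_rhs => rw [this]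
      rw [Finset.mul_sum, Finset.mul_sum, Finset.sum_mul, ← Finset.sum_sub_distrib]
      exact Finset.sum_congr rfl fun k _ => by ring
    rw [← Finset.add_sum_erase _ _ (Finset.mem_univ 0)] at h2
    linear_combination -h2
  have h2 : ∀ k ∈ Finset.univ.erase (0 : Fin (n + 1)),
      |2 * edgeWeight p q n k e * (eigenMean p q n F k - flatMean n F)|
        ≤ (1 + D) * D / (2 * (n + 1) ^ 2) * |T k| := by
    intro k hk
    have hk0 : k ≠ 0 := Finset.ne_of_mem_erase hk
    have hb := abs_sub_div_phaseSinSq_le hp hq hpq (angle n k)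
    rw [eigenMean_of_ne_zero F hk0, add_sub_cancel_left]
    simp only [edgeWeight, hk0, if_false]
    rw [show 2 * (1 / (2 * ((n : ℝ) + 1)) * (1 + (p - q) * oscillation p q (angle n k) e
        / phaseSinSq p q (angle n k))) * (1 / (2 * (n + 1)) *
        ((p - q) / phaseSinSq p q (angle n k) * ∑ e ∈ Finset.range (n + 1),
        oscillation p q (angle n k) e * (F (e / n) + F ((e + 1) / n))))
      = 1 / (2 * (n + 1) ^ 2) * ((1 + (p - q) / phaseSinSq p q (angle n k)
          * oscillation p q (angle n k) e) * ((p - q) / phaseSinSq p q (angle n k)) * T k) by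
        simp only [hT, hG]; field_simp]
    rw [abs_mul, abs_mul, abs_mul, abs_of_pos (show 0 < 1 / (2 * ((n : ℝ) + 1) ^ 2) by positivity),
      ← mul_assoc, div_eq_mul_one_div ((1 + D) * D), mul_comm ((1 + D) * D)]
    gcongr
    calc |1 + (p - q) / phaseSinSq p q (angle n k) * oscillation p q (angle n k) e|
        ≤ |1| + |(p - q) / phaseSinSq p q (angle n k) * oscillation p q (angle n k) e| :=
          abs_add_le _ _
      _ ≤ 1 + D * 1 := by
          rw [abs_one, abs_mul]
          gcongr
          exact abs_oscillation_le_one hD1 _ _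
      _ = 1 + D := by ring
  -- Cauchy–Schwarz over `k` and the mean square bound give the power `3`; against the squared
  -- prefactor of order `(n + 1)^(-4)` this leaves `1 / (n + 1)`.
  have h3 : (∑ k ∈ Finset.univ.erase (0 : Fin (n + 1)), |T k|) ^ 2
      ≤ 4 * B ^ 2 * (n + 1) ^ 3 := by
    have hG2 : ∑ e ∈ Finset.range (n + 1), G e ^ 2 ≤ (n + 1) * (4 * B ^ 2) := by
      have : ∀ e ∈ Finset.range (n + 1), G e ^ 2 ≤ 4 * B ^ 2 := by
        intro e _
        have : |G e| ≤ 2 * B := (abs_add_le _ _).trans (by linarith [hF (e / n), hF ((e + 1) / n)])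
        calc G e ^ 2 = |G e| ^ 2 := (sq_abs _).symm
          _ ≤ (2 * B) ^ 2 := by gcongr
          _ = 4 * B ^ 2 := by ring
      simpa using Finset.sum_le_card_nsmul _ _ _ this
    calc (∑ k ∈ Finset.univ.erase (0 : Fin (n + 1)), |T k|) ^ 2
        ≤ (∑ k : Fin (n + 1), |T k|) ^ 2 := by
          gcongr
          exact Finset.subset_univ _
      _ ≤ (n + 1) * ∑ k : Fin (n + 1), |T k| ^ 2 := by
          simpa using sq_sum_le_card_mul_sum_sq (s := (Finset.univ : Finset (Fin (n + 1))))
            (f := fun k => |T k|)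
      _ = (n + 1) * ∑ k ∈ Finset.range (n + 1), T k ^ 2 := by
          simp only [sq_abs]
          rw [Fin.sum_univ_eq_sum_range (fun k => T k ^ 2)]
      _ ≤ (n + 1) * ((n + 1) * ((n + 1) * (4 * B ^ 2))) := by
          gcongr
          exact (sum_sq_sum_oscillation_le hD1 G).trans (by gcongr)
      _ = 4 * B ^ 2 * (n + 1) ^ 3 := by ring
  apply Real.abs_le_sqrt
  rw [h1, ← sq_abs]
  calc |∑ k ∈ Finset.univ.erase (0 : Fin (n + 1)),
        2 * edgeWeight p q n k e * (eigenMean p q n F k - flatMean n F)| ^ 2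
      ≤ ((1 + D) * D / (2 * (n + 1) ^ 2) *
          ∑ k ∈ Finset.univ.erase (0 : Fin (n + 1)), |T k|) ^ 2 := by
        gcongr
        rw [Finset.mul_sum]
        exact (Finset.abs_sum_le_sum_abs _ _).trans (Finset.sum_le_sum h2)
    _ = ((1 + D) * D / (2 * (n + 1) ^ 2)) ^ 2 *
          (∑ k ∈ Finset.univ.erase (0 : Fin (n + 1)), |T k|) ^ 2 := by rw [mul_pow]
    _ ≤ ((1 + D) * D / (2 * (n + 1) ^ 2)) ^ 2 * (4 * B ^ 2 * (n + 1) ^ 3) := by gcongr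
    _ = (B * ((1 + D) * D)) ^ 2 / (n + 1) := by field_simp; ring

/-! ### Limits of the overlap with the stationary states. -/

/-- The overlap of the initial state with the stationary states, for the starting vertex `i`. -/
def overlap (p q : ℝ) (n : ℕ) (i : Fin (n + 2)) : ℝ :=
  (∑ s ∈ startStates n i, 2 * edgeWeight p q n 0 s.edge) / ((startStates n i).card : ℝ)

theorem abs_integral_scaledLaw_sub_le {p q : ℝ} (hp : 0 < p) (hq : 0 < q) (hpq : p + q = 1)
    {n : ℕ} (i : Fin (n + 2)) {F : ℝ → ℝ} {B : ℝ} (hF : ∀ x, |F x| ≤ B) :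
    |∫ y, F y ∂scaledLaw p q n i - (overlap p q n i * eigenMean p q n F 0
        + (1 - overlap p q n i) * flatMean n F)|
      ≤ √((B * ((1 + 1 / |p - q|) * (1 / |p - q|))) ^ 2 / (n + 1)) := by
  set δ := √((B * ((1 + 1 / |p - q|) * (1 / |p - q|))) ^ 2 / (n + 1)) with hδ
  have hc := card_startStates_pos i
  have h1 : ∫ y, F y ∂scaledLaw p q n i - (overlap p q n i * eigenMean p q n F 0
        + (1 - overlap p q n i) * flatMean n F)
      = (∑ s ∈ startStates n i, (edgeMean p q n F s.edge -
        (2 * edgeWeight p q n 0 s.edge * eigenMean p q n F 0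
          + (1 - 2 * edgeWeight p q n 0 s.edge) * flatMean n F))) / (startStates n i).card := by
    rw [integral_scaledLaw hp hq hpq, overlap]
    simp only [Finset.sum_sub_distrib, Finset.sum_add_distrib, ← Finset.sum_mul,
      Finset.sum_const, nsmul_eq_mul, mul_one]
    field_simp
  rw [h1, abs_div, abs_of_pos hc, div_le_iff₀ hc]
  calc _ ≤ ∑ s ∈ startStates n i, |edgeMean p q n F s.edge -
        (2 * edgeWeight p q n 0 s.edge * eigenMean p q n F 0
          + (1 - 2 * edgeWeight p q n 0 s.edge) * flatMean n F)| :=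
        Finset.abs_sum_le_sum_abs _ _
    _ ≤ ∑ s ∈ startStates n i, δ :=
        Finset.sum_le_sum fun s _ => abs_edgeMean_sub_le hp hq hpq hF s.edge
    _ = δ * (startStates n i).card := by rw [Finset.sum_const, nsmul_eq_mul, mul_comm]

theorem overlap_nonneg {p q : ℝ} (hp : 0 < p) (hq : 0 < q) (hpq : p + q = 1) {n : ℕ}
    (i : Fin (n + 2)) : 0 ≤ overlap p q n i :=
  div_nonneg (Finset.sum_nonneg fun _ _ =>
    mul_nonneg zero_le_two (edgeWeight_nonneg hp hq hpq _ _)) (card_startStates_pos i).le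

theorem overlap_le {p q : ℝ} {n : ℕ} (i : Fin (n + 2)) {η : ℝ}
    (h : ∀ e : Fin (n + 1), (e : ℕ) ≤ i → (i : ℕ) ≤ e + 1 → 2 * edgeWeight p q n 0 e ≤ η) :
    overlap p q n i ≤ η := by
  rw [overlap, div_le_iff₀ (card_startStates_pos i), mul_comm, ← nsmul_eq_mul]
  refine Finset.sum_le_card_nsmul _ _ _ fun s hs => ?_
  have hs' : s.pos = i := by simpa [startStates] using hs
  subst hs'
  rcases s.eq_arcR_or_arcL with ⟨e, rfl⟩ | ⟨e, rfl⟩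
  · exact h _ (by simp) (by simp)
  · exact h _ (by simp) (by simp)

theorem overlap_le_one {p q : ℝ} (hp : 0 < p) (hq : 0 < q) (hpq : p + q = 1) {n : ℕ}
    (i : Fin (n + 2)) : overlap p q n i ≤ 1 := by
  refine overlap_le i fun e _ _ => ?_
  rw [← two_mul_sum_edgeWeight hp hq hpq e]
  gcongr
  exact Finset.single_le_sum (f := fun k => edgeWeight p q n k e)
    (fun k _ => edgeWeight_nonneg hp hq hpq k e) (Finset.mem_univ 0)

theorem two_mul_edgeWeight_zero (p q : ℝ) (n e : ℕ) :
    2 * edgeWeight p q n 0 e = (p / q) ^ e / ∑ j ∈ Finset.range (n + 1), (p / q) ^ j := by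
  rw [edgeWeight, if_pos rfl]
  rw [mul_div_mul_left _ _ (two_ne_zero' ℝ) |>.symm]
  ring

theorem pow_le_sum_pow {x : ℝ} (hx : 0 ≤ x) {n m : ℕ} (hm : m ≤ n) :
    x ^ m ≤ ∑ j ∈ Finset.range (n + 1), x ^ j :=
  Finset.single_le_sum (f := fun j => x ^ j) (fun j _ => by positivity)
    (Finset.mem_range.mpr (Nat.lt_succ_of_le hm))

/-- An edge at the vertex `i` is `i - 1` or `i`. Its doubled stationary weight is at most
`(p/q)^(i-1)` if `p < q`, equals `1/(n+1)` if `p = q`, and is at most `(q/p)^(n-i)` if `p > q` and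
`i ≤ n`. -/
theorem tendsto_overlap_zero {p q : ℝ} (hp : 0 < p) (hq : 0 < q) (hpq : p + q = 1)
    (i : (n : ℕ) → Fin (n + 2))
    (hlt : p < q → Tendsto (fun n => ((i n : ℕ))) atTop atTop)
    (hgt : q < p → Tendsto (fun n : ℕ => (n : ℝ) - ((i n : ℕ) : ℝ)) atTop atTop) :
    Tendsto (fun n => overlap p q n (i n)) atTop (𝓝 0) := by
  have hx : 0 < p / q := by positivity
  rcases lt_trichotomy p q with h | h | h
  · have hx1 : p / q < 1 := (div_lt_one hq).mpr h
    have ht : Tendsto (fun n => (p / q)⁻¹ * (p / q) ^ ((i n : ℕ))) atTop (𝓝 0) := by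
      simpa using ((tendsto_pow_atTop_nhds_zero_of_lt_one hx.le hx1).comp (hlt h)).const_mul
        (p / q)⁻¹
    refine squeeze_zero (fun n => overlap_nonneg hp hq hpq _) (fun n => ?_) ht
    refine overlap_le _ fun e _ he => ?_
    rw [two_mul_edgeWeight_zero]
    have h1 : 1 ≤ ∑ j ∈ Finset.range (n + 1), (p / q) ^ j := by
      simpa using pow_le_sum_pow hx.le (Nat.zero_le n)
    calc (p / q) ^ (e : ℕ) / ∑ j ∈ Finset.range (n + 1), (p / q) ^ j
        ≤ (p / q) ^ (e : ℕ) := div_le_self (by positivity) h1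
      _ = (p / q)⁻¹ * (p / q) ^ ((e : ℕ) + 1) := by rw [pow_succ]; field_simp
      _ ≤ _ := by
        gcongr (p / q)⁻¹ * ?_
        exact pow_le_pow_of_le_one hx.le hx1.le he
  · refine squeeze_zero (fun n => overlap_nonneg hp hq hpq _) (fun n => ?_)
      (tendsto_one_div_add_atTop_nhds_zero_nat (𝕜 := ℝ))
    refine overlap_le _ fun e _ he => ?_
    rw [two_mul_edgeWeight_zero, h, div_self hq.ne']
    simp
  · have hx1 : 1 < p / q := (one_lt_div hq).mpr h
    have hy1 : (p / q)⁻¹ < 1 := inv_lt_one_of_one_lt₀ hx1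
    have hni : Tendsto (fun n : ℕ => n - (i n : ℕ)) atTop atTop := by
      refine tendsto_atTop.mpr fun b => ?_
      filter_upwards [(tendsto_atTop.mp (hgt h)) b] with n hn
      have h2 : b + (i n : ℕ) ≤ n := by
        have : (b : ℝ) + ((i n : ℕ) : ℝ) ≤ n := by linarith
        exact_mod_cast this
      omega
    refine squeeze_zero (fun n => overlap_nonneg hp hq hpq _) (fun n => ?_)
      ((tendsto_pow_atTop_nhds_zero_of_lt_one (by positivity) hy1).comp hni)
    refine overlap_le _ fun e he _ => ?_
    rw [two_mul_edgeWeight_zero]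
    have hen : (e : ℕ) ≤ n := Nat.lt_succ_iff.mp e.is_lt
    calc (p / q) ^ (e : ℕ) / ∑ j ∈ Finset.range (n + 1), (p / q) ^ j
        ≤ (p / q) ^ (e : ℕ) / (p / q) ^ n := by
          gcongr
          exact pow_le_sum_pow hx.le le_rfl
      _ = (p / q)⁻¹ ^ (n - e) := by
          rw [inv_pow, pow_sub₀ _ hx.ne' hen]; field_simp
      _ ≤ (p / q)⁻¹ ^ (n - (i n : ℕ)) :=
          pow_le_pow_of_le_one (by positivity) hy1.le (by omega)

theorem tendsto_sum_pow_inv {p q : ℝ} (hp : 0 < p) (hq : 0 < q) (h : p < q) :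
    Tendsto (fun n : ℕ => (∑ j ∈ Finset.range (n + 1), (p / q) ^ j)⁻¹) atTop
      (𝓝 (1 - p / q)) := by
  have hx : 0 < p / q := by positivity
  have hx1 : p / q < 1 := (div_lt_one hq).mpr h
  have h1 := ((hasSum_geometric_of_lt_one hx.le hx1).tendsto_sum_nat.comp
    (tendsto_add_atTop_nat 1)).inv₀ (inv_ne_zero (by linarith))
  simpa using h1

theorem overlap_zero {p q : ℝ} {n : ℕ} {i : Fin (n + 2)} (hi : (i : ℕ) = 0) :
    overlap p q n i = 2 * edgeWeight p q n 0 0 := by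
  have : startStates n i = {arcR 0} := by
    ext s
    rcases s.eq_arcR_or_arcL with ⟨e, rfl⟩ | ⟨e, rfl⟩
    · have he : e.castSucc = i ↔ e = 0 := by rw [Fin.ext_iff, Fin.ext_iff, hi]; rfl
      simp [startStates, he, arcR_injective.eq_iff]
    · have he : e.succ ≠ i := fun h => by
        have h1 := congrArg Fin.val h
        rw [Fin.val_succ, hi] at h1
        omega
      simp [startStates, he, (arcR_ne_arcL _ _).symm]
  simp [overlap, this]

theorem overlap_succ {p q : ℝ} {n m : ℕ} {i : Fin (n + 2)} (hi : (i : ℕ) = m + 1)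
    (hm : m + 1 < n + 1) :
    overlap p q n i = (2 * edgeWeight p q n 0 (m + 1) + 2 * edgeWeight p q n 0 m) / 2 := by
  have : startStates n i = {arcR ⟨m + 1, hm⟩, arcL ⟨m, by omega⟩} := by
    ext s
    rcases s.eq_arcR_or_arcL with ⟨e, rfl⟩ | ⟨e, rfl⟩
    · have he : e.castSucc = i ↔ e = ⟨m + 1, hm⟩ := by
        rw [Fin.ext_iff, Fin.ext_iff, hi]; rfl
      simp [startStates, he, arcR_injective.eq_iff, arcR_ne_arcL]
    · have he : e.succ = i ↔ e = ⟨m, by omega⟩ := by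
        rw [Fin.ext_iff, Fin.ext_iff, hi, Fin.val_succ]
        exact Nat.succ_inj
      simp [startStates, he, arcL_injective.eq_iff, (arcR_ne_arcL _ _).symm]
  rw [overlap, this, Finset.sum_pair (arcR_ne_arcL _ _), Finset.card_pair (arcR_ne_arcL _ _)]
  simp

/-- The vertex `0` has one arc. An inner vertex averages two consecutive geometric weights, and `p/q
+ 1 = 1/q` turns the average into the factor `1/(2q)`. -/
theorem tendsto_overlap_of_lt {p q : ℝ} (hp : 0 < p) (hq : 0 < q) (hpq : p + q = 1) (h : p < q)
    {i₀ : ℕ} {i : (n : ℕ) → Fin (n + 2)} (hi : ∀ᶠ n in atTop, ((i n : ℕ) = i₀)) :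
    Tendsto (fun n => overlap p q n (i n)) atTop (𝓝 (originMass p q i₀)) := by
  have hS := tendsto_sum_pow_inv hp hq h
  rw [originMass, if_pos h]
  rcases i₀ with _ | m
  · rw [if_pos rfl]
    refine hS.congr' ?_
    filter_upwards [hi] with n hn
    rw [overlap_zero hn, two_mul_edgeWeight_zero]
    simp
  · rw [if_neg (Nat.succ_ne_zero m), Nat.add_sub_cancel]
    have h1 := hS.const_mul (((p / q) ^ (m + 1) + (p / q) ^ m) / 2)
    have h2 : ((p / q) ^ (m + 1) + (p / q) ^ m) / 2 * (1 - p / q)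
        = 1 / (2 * q) * (1 - p / q) * (p / q) ^ m := by
      have h3 : p / q + 1 = 1 / q := by field_simp; exact hpq
      rw [show (p / q) ^ (m + 1) + (p / q) ^ m = (p / q + 1) * (p / q) ^ m by ring, h3]
      field_simp
    rw [h2] at h1
    refine h1.congr' ?_
    filter_upwards [hi, eventually_gt_atTop (m + 1)] with n hn hmn
    rw [overlap_succ hn (by omega), two_mul_edgeWeight_zero, two_mul_edgeWeight_zero]
    ring

/-! ### Limits of the stationary and flat means. -/

theorem eigenMean_zero_bound {p q : ℝ} (hp : 0 < p) (hq : 0 < q) (hpq : p + q = 1) {n : ℕ}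
    {F : ℝ → ℝ} {B : ℝ} (hF : ∀ x, |F x| ≤ B) : |eigenMean p q n F 0| ≤ B := by
  calc |eigenMean p q n F 0|
      ≤ ∑ e ∈ Finset.range (n + 1), edgeWeight p q n 0 e * (2 * B) := by
        refine (Finset.abs_sum_le_sum_abs _ _).trans (Finset.sum_le_sum fun e he => ?_)
        have hw := edgeWeight_nonneg hp hq hpq (0 : Fin (n + 1)) ⟨e, Finset.mem_range.mp he⟩
        rw [abs_mul, abs_of_nonneg hw]
        gcongr
        exact (abs_add_le _ _).trans (by linarith [hF (e / n), hF ((e + 1) / n)])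
    _ = B := by rw [← Finset.sum_mul, sum_edgeWeight hp hq]; ring

/-- The geometric state has bounded mean distance from the origin, uniformly in `n`, so after
scaling a Lipschitz function changes by `O(1/n)`. -/
theorem tendsto_eigenMean_zero {p q : ℝ} (hp : 0 < p) (hq : 0 < q) (hpq : p + q = 1) (h : p < q)
    {F : ℝ → ℝ} {L : NNReal} (hF : LipschitzWith L F) :
    Tendsto (fun n => eigenMean p q n F 0) atTop (𝓝 (F 0)) := by
  have hx : 0 < p / q := by positivity
  have hx1 : p / q < 1 := (div_lt_one hq).mpr h
  have hsum : Summable fun e : ℕ => (p / q) ^ e * (2 * e + 1) := by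
    have h1 := summable_pow_mul_geometric_of_norm_lt_one 1
      (r := p / q) (by rwa [Real.norm_eq_abs, abs_of_pos hx])
    have h2 := summable_geometric_of_lt_one hx.le hx1
    refine ((h1.mul_left 2).add h2).congr fun e => ?_
    rw [pow_one]; ring
  set K := ∑' e : ℕ, (p / q) ^ e * (2 * (e : ℝ) + 1) with hK
  have ht : Tendsto (fun n : ℕ => (L / 2 * K) * (1 / (n : ℝ))) atTop (𝓝 0) := by
    simpa using (tendsto_one_div_atTop_nhds_zero_nat (𝕜 := ℝ)).const_mul (L / 2 * K)
  rw [tendsto_iff_dist_tendsto_zero]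
  -- The bound includes `n = 0`, where every quotient by `n` is `0` and both sides vanish.
  refine squeeze_zero (fun _ => dist_nonneg) (fun n => ?_) ht
  have h0 : eigenMean p q n F 0 - F 0 = ∑ e ∈ Finset.range (n + 1),
      edgeWeight p q n 0 e * (F (e / n) - F 0 + (F ((e + 1) / n) - F 0)) := by
    have hs := sum_edgeWeight hp hq (0 : Fin (n + 1))
    have : F 0 = ∑ e ∈ Finset.range (n + 1), edgeWeight p q n 0 e * (2 * F 0) := by
      rw [← Finset.sum_mul]
      rw [hs]; ring
    conv_lhs => rw [this]
    rw [eigenMean, ← Finset.sum_sub_distrib]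
    exact Finset.sum_congr rfl fun e _ => by ring
  have hL : ∀ x : ℝ, 0 ≤ x → |F x - F 0| ≤ L * x := by
    intro x hx0
    have := hF.dist_le_mul x 0
    rwa [Real.dist_eq, Real.dist_eq, sub_zero, abs_of_nonneg hx0] at this
  rw [Real.dist_eq, h0]
  calc _ ≤ ∑ e ∈ Finset.range (n + 1), L / 2 * ((p / q) ^ e * (2 * e + 1)) * (1 / n) := by
        refine (Finset.abs_sum_le_sum_abs _ _).trans (Finset.sum_le_sum fun e he => ?_)
        have hw := edgeWeight_nonneg hp hq hpq (0 : Fin (n + 1)) ⟨e, Finset.mem_range.mp he⟩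
        have hS : 1 ≤ ∑ j ∈ Finset.range (n + 1), (p / q) ^ j := by
          simpa using pow_le_sum_pow hx.le (Nat.zero_le n)
        have hw2 : edgeWeight p q n 0 e ≤ (p / q) ^ e / 2 := by
          have h3 : (p / q) ^ e / (∑ j ∈ Finset.range (n + 1), (p / q) ^ j) ≤ (p / q) ^ e :=
            div_le_self (by positivity) hS
          rw [← two_mul_edgeWeight_zero] at h3
          linarith
        rw [abs_mul, abs_of_nonneg hw]
        calc edgeWeight p q n 0 e * |F (e / n) - F 0 + (F ((e + 1) / n) - F 0)|
            ≤ (p / q) ^ e / 2 * (L * (e / n) + L * ((e + 1) / n)) := by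
              gcongr
              exact (abs_add_le _ _).trans (add_le_add (hL _ (by positivity))
                (hL _ (by positivity)))
          _ = _ := by ring
    _ = L / 2 * (∑ e ∈ Finset.range (n + 1), (p / q) ^ e * (2 * (e : ℝ) + 1)) * (1 / n) := by
        rw [Finset.mul_sum, Finset.sum_mul]
    _ ≤ L / 2 * K * (1 / n) := by
        gcongr
        exact hsum.sum_le_tsum _ fun e _ => by positivity

/-- A Riemann sum over the `n + 1` cells `[e/(n+1), (e+1)/(n+1)]`; the sample points `e/n` and
`(e+1)/n` may lie outside the cell, but within `2/n` of each of its points. -/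
theorem tendsto_flatMean {F : ℝ → ℝ} {L : NNReal} (hF : LipschitzWith L F) :
    Tendsto (fun n => flatMean n F) atTop (𝓝 (∫ x in (0 : ℝ)..1, F x)) := by
  have ht : Tendsto (fun n : ℕ => (2 * L) * (1 / (n : ℝ))) atTop (𝓝 0) := by
    simpa using (tendsto_one_div_atTop_nhds_zero_nat (𝕜 := ℝ)).const_mul (2 * (L : ℝ))
  rw [tendsto_iff_dist_tendsto_zero]
  refine squeeze_zero' (Eventually.of_forall fun _ => dist_nonneg) ?_ ht
  filter_upwards [eventually_gt_atTop 0] with n hn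
  have hn0 : (0 : ℝ) < n := by exact_mod_cast hn
  have hn1 : (0 : ℝ) < n + 1 := by positivity
  set a : ℕ → ℝ := fun e => e / (n + 1) with ha
  have hint : ∀ x y : ℝ, IntervalIntegrable F volume x y := fun x y =>
    hF.continuous.intervalIntegrable x y
  have hsplit : ∫ x in (0 : ℝ)..1, F x
      = ∑ e ∈ Finset.range (n + 1), ∫ x in a e..a (e + 1), F x := by
    rw [intervalIntegral.sum_integral_adjacent_intervals fun k _ => hint _ _]
    have h0 : a 0 = 0 := by simp [ha]
    have h1 : a (n + 1) = 1 := by simp only [ha]; push_cast; exact div_self hn1.ne'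
    rw [h0, h1]
  have hlen : ∀ e : ℕ, a (e + 1) - a e = 1 / (n + 1) := by
    intro e; simp only [ha]; push_cast; ring
  have hterm : ∀ e ∈ Finset.range (n + 1),
      |1 / (2 * (n + 1)) * (F (e / n) + F ((e + 1) / n)) - ∫ x in a e..a (e + 1), F x|
        ≤ 2 * L * (1 / n) * (1 / (n + 1)) := by
    intro e he
    have hen : (e : ℝ) ≤ n := by exact_mod_cast Nat.lt_succ_iff.mp (Finset.mem_range.mp he)
    have he0 : (0 : ℝ) ≤ e := by positivity
    have hle : a e ≤ a (e + 1) := by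
      have := hlen e
      have : 0 < 1 / ((n : ℝ) + 1) := by positivity
      linarith
    have h1 : 1 / (2 * ((n : ℝ) + 1)) * (F (e / n) + F ((e + 1) / n))
        - ∫ x in a e..a (e + 1), F x
        = ∫ x in a e..a (e + 1), ((F (e / n) + F ((e + 1) / n)) / 2 - F x) := by
      rw [intervalIntegral.integral_sub (by simp) (hint _ _), intervalIntegral.integral_const,
        hlen, smul_eq_mul, show 1 / (2 * ((n : ℝ) + 1)) = 1 / (n + 1) / 2 by field_simp]
      ring
    rw [h1]
    have h2 := intervalIntegral.norm_integral_le_of_norm_le_const (a := a e) (b := a (e + 1))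
      (f := fun x => (F (e / n) + F ((e + 1) / n)) / 2 - F x) (C := 2 * L * (1 / n)) ?_
    · rwa [Real.norm_eq_abs, hlen, abs_of_pos (show 0 < 1 / ((n : ℝ) + 1) by positivity)] at h2
    · intro x hx
      rw [Set.uIoc_of_le hle] at hx
      have hx1 : (e : ℝ) / (n + 1) ≤ x := hx.1.le
      have hx2 : x ≤ ((e : ℝ) + 1) / (n + 1) := by simpa [ha] using hx.2
      have e1 : (e : ℝ) / n - e / (n + 1) = e / n / (n + 1) := by field_simp; ring
      have e2 : (e : ℝ) / n / (n + 1) ≤ 1 / (n + 1) := by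
        gcongr; exact (div_le_one hn0).mpr hen
      have e3 : 1 / ((n : ℝ) + 1) ≤ 1 / n := by gcongr; linarith
      have e4 : ((e : ℝ) + 1) / (n + 1) = e / (n + 1) + 1 / (n + 1) := by ring
      have e5 : ((e : ℝ) + 1) / n = e / n + 1 / n := by ring
      have e6 : 0 ≤ (e : ℝ) / n / (n + 1) := by positivity
      have e8 : 0 < 1 / (n : ℝ) := by positivity
      have d1 := hF.dist_le_mul (e / n) x
      have d2 := hF.dist_le_mul ((e + 1) / n) x
      rw [Real.dist_eq, Real.dist_eq] at d1 d2
      have b1 : |(e : ℝ) / n - x| ≤ 2 * (1 / n) := by rw [abs_le]; constructor <;> linarith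
      have b2 : |((e : ℝ) + 1) / n - x| ≤ 2 * (1 / n) := by
        rw [abs_le]; constructor <;> linarith
      have c1 : |F (e / n) - F x| ≤ L * (2 * (1 / n)) := d1.trans (by gcongr)
      have c2 : |F ((e + 1) / n) - F x| ≤ L * (2 * (1 / n)) := d2.trans (by gcongr)
      rw [Real.norm_eq_abs]
      rw [abs_le] at c1 c2 ⊢
      constructor <;> linarith [c1.1, c1.2, c2.1, c2.2]
  rw [Real.dist_eq, hsplit, flatMean, Finset.mul_sum, ← Finset.sum_sub_distrib]
  refine (Finset.abs_sum_le_sum_abs _ _).trans ((Finset.sum_le_sum hterm).trans ?_)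
  rw [Finset.sum_const, Finset.card_range, nsmul_eq_mul]
  push_cast
  exact le_of_eq (by field_simp)

/-! ### Weak convergence to the mixture. -/

theorem integral_uniform01 (F : ℝ → ℝ) : ∫ x, F x ∂uniform01 = ∫ x in (0 : ℝ)..1, F x := by
  rw [uniform01, intervalIntegral.integral_of_le zero_le_one, integral_Icc_eq_integral_Ioc]

instance isProbabilityMeasure_uniform01 : IsProbabilityMeasure uniform01 :=
  ⟨by simp [uniform01]⟩

theorem isProbabilityMeasure_mixture {c : ℝ} (h0 : 0 ≤ c) (h1 : c ≤ 1) :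
    IsProbabilityMeasure (mixture c) := by
  constructor
  simp only [mixture, Measure.add_apply, Measure.smul_apply, measure_univ, smul_eq_mul, mul_one]
  rw [← ENNReal.ofReal_add h0 (by linarith)]
  simp

theorem mixture_zero : mixture 0 = uniform01 := by simp [mixture]

theorem integral_mixture {c : ℝ} (h0 : 0 ≤ c) (h1 : c ≤ 1) {F : ℝ → ℝ} {B : ℝ}
    (hc : Continuous F) (hF : ∀ x, |F x| ≤ B) :
    ∫ x, F x ∂mixture c = c * F 0 + (1 - c) * ∫ x in (0 : ℝ)..1, F x := by
  have hi : ∀ μ : Measure ℝ, [IsProbabilityMeasure μ] → Integrable F μ := fun μ _ =>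
    Integrable.of_bound hc.aestronglyMeasurable B (Eventually.of_forall hF)
  rw [mixture, integral_add_measure ((hi _).smul_measure ENNReal.ofReal_ne_top)
    ((hi _).smul_measure ENNReal.ofReal_ne_top), integral_smul_measure, integral_smul_measure,
    integral_dirac, integral_uniform01, ENNReal.toReal_ofReal h0,
    ENNReal.toReal_ofReal (by linarith), smul_eq_mul, smul_eq_mul]

/-- The alternative `h` covers the stationary term: if `c = 0`, boundedness of its mean suffices; if
`p < q`, its mean converges to the value at the origin. -/
theorem weaklyConverges_mixture {p q : ℝ} (hp : 0 < p) (hq : 0 < q) (hpq : p + q = 1) {c : ℝ}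
    {i : (n : ℕ) → Fin (n + 2)} (hc : Tendsto (fun n => overlap p q n (i n)) atTop (𝓝 c))
    (h : c = 0 ∨ p < q) :
    WeaklyConverges (fun n => scaledLaw p q n (i n)) (mixture c) := by
  have hc0 : 0 ≤ c := ge_of_tendsto' hc fun n => overlap_nonneg hp hq hpq _
  have hc1 : c ≤ 1 := le_of_tendsto' hc fun n => overlap_le_one hp hq hpq _
  refine ⟨fun n => isProbabilityMeasure_scaledLaw hp hq hpq _,
    isProbabilityMeasure_mixture hc0 hc1, ?_⟩
  refine tendsto_iff_forall_lipschitz_integral_tendsto.mpr ?_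
  rintro F ⟨C, hC⟩ ⟨L, hL⟩
  obtain ⟨B, hB⟩ : ∃ B, ∀ x, |F x| ≤ B := by
    refine ⟨|F 0| + C, fun x => ?_⟩
    have h1 := hC x 0
    rw [Real.dist_eq] at h1
    have h2 := abs_add_le (F 0) (F x - F 0)
    rw [add_sub_cancel] at h2
    linarith
  change Tendsto (fun n => ∫ x, F x ∂scaledLaw p q n (i n)) atTop (𝓝 (∫ x, F x ∂mixture c))
  rw [integral_mixture hc0 hc1 hL.continuous hB]
  have hfirst : Tendsto (fun n => overlap p q n (i n) * eigenMean p q n F 0) atTop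
      (𝓝 (c * F 0)) := by
    rcases h with rfl | h
    · rw [zero_mul]
      exact hc.zero_mul_isBoundedUnder_le
        (isBoundedUnder_of ⟨B, fun n => eigenMean_zero_bound hp hq hpq hB⟩)
    · exact hc.mul (tendsto_eigenMean_zero hp hq hpq h hL)
  have hmain := hfirst.add ((hc.const_sub 1).mul (tendsto_flatMean hL))
  have herr : Tendsto (fun n : ℕ =>
      √((B * ((1 + 1 / |p - q|) * (1 / |p - q|))) ^ 2 / (n + 1))) atTop (𝓝 0) := by
    have h1 := (tendsto_one_div_add_atTop_nhds_zero_nat (𝕜 := ℝ)).const_mul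
      ((B * ((1 + 1 / |p - q|) * (1 / |p - q|))) ^ 2)
    have h2 := (Real.continuous_sqrt.tendsto _).comp h1
    simpa [Function.comp_def, ← div_eq_mul_inv] using h2
  have hdiff : Tendsto (fun n => ∫ x, F x ∂scaledLaw p q n (i n) -
      (overlap p q n (i n) * eigenMean p q n F 0 + (1 - overlap p q n (i n)) * flatMean n F))
      atTop (𝓝 0) := squeeze_zero_norm (fun n => abs_integral_scaledLaw_sub_le hp hq hpq (i n) hB) herr
  simpa using hdiff.add hmain

end PathWalk

theorem theorem1 (p q : ℝ) (hp : 0 < p) (hq : 0 < q) (hpq : p + q = 1) :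
    -- the limits that define the time averaged distribution exist
    (∀ (n : ℕ) (i x : Fin (n + 2)),
      Tendsto (PathWalk.finiteTimeAverage p q n i x) atTop
        (𝓝 (PathWalk.timeAveraged p q n i x))) ∧
    -- a fixed starting vertex
    (∀ (i₀ : ℕ) (i : (n : ℕ) → Fin (n + 2)),
      (∀ᶠ n in atTop, ((i n : ℕ) = i₀)) →
      PathWalk.WeaklyConverges (fun n => PathWalk.scaledLaw p q n (i n))
        (PathWalk.mixture (PathWalk.originMass p q i₀))) ∧
    -- a starting vertex that grows with `n`
    (∀ (r : ℝ) (f : ℕ → ℝ) (i : (n : ℕ) → Fin (n + 2)),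
      0 < r → r < 1 → (∀ᶠ n : ℕ in atTop, r * f n ≤ (n : ℝ)) →
      Tendsto f atTop atTop →
      Tendsto (fun n => ((i n : ℕ) : ℝ) / f n) atTop (𝓝 r) →
      (q < p → Tendsto (fun n : ℕ => (n : ℝ) - ((i n : ℕ) : ℝ)) atTop atTop) →
      PathWalk.WeaklyConverges (fun n => PathWalk.scaledLaw p q n (i n))
        PathWalk.uniform01) := by
  refine ⟨fun n i x => ?_, fun i₀ i hi => ?_, fun r f i hr _ _ hf hif hgt => ?_⟩
  · rw [PathWalk.timeAveraged_eq hp hq hpq]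
    exact PathWalk.tendsto_finiteTimeAverage hp hq hpq i x
  · by_cases h : p < q
    · exact PathWalk.weaklyConverges_mixture hp hq hpq
        (PathWalk.tendsto_overlap_of_lt hp hq hpq h hi) (Or.inr h)
    · rw [PathWalk.originMass, if_neg h]
      refine PathWalk.weaklyConverges_mixture hp hq hpq
        (PathWalk.tendsto_overlap_zero hp hq hpq i (fun h' => absurd h' h) fun _ => ?_) (Or.inl rfl)
      refine (tendsto_atTop_add_const_right atTop (-(i₀ : ℝ))
        (tendsto_natCast_atTop_atTop (R := ℝ))).congr' ?_
      filter_upwards [hi] with n hn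
      rw [hn, sub_eq_add_neg]
  · rw [← PathWalk.mixture_zero]
    refine PathWalk.weaklyConverges_mixture hp hq hpq
      (PathWalk.tendsto_overlap_zero hp hq hpq i (fun _ => ?_) hgt) (Or.inl rfl)
    rw [← tendsto_natCast_atTop_iff (R := ℝ)]
    -- The start tends to infinity as the product of `i n / f n → r > 0` and `f n → ∞`.
    refine (hif.pos_mul_atTop hr hf).congr' ?_
    filter_upwards [hf.eventually_gt_atTop 0] with n hn
    exact div_mul_cancel₀ _ hn.ne'

end
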